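/- All graphs are finite, undirected, without loops and without parallel edges. Let $v(G)$ denote the number of vertices of a graph $G$. A graph is *claw-free* if it has no induced subgraph isomorphic to $K_{1,3}$. A graph $G$ is *3-connected* if $v(G) > 3$ and $G - S$ is connected for every set $S$ of fewer than three vertices. A *$\Lambda$-factor* of a graph is a spanning subgraph each of whose connected components is a 3-vertex path. For a vertex $x$ and an edge $e$ of $G$, let $G - \{x,e\}$ denote the graph obtained from $G$ by deleting the vertex $x$ together with all edges incident to it, and deleting the edge $e$ (but not its end-vertices other than $x$); here $e$ may or may not be incident to $x$. **Theorem.** Suppose that $G$ is a 3-connected claw-free graph with $v(G) \equiv 1 \pmod 3$, $x \in V(G)$ and $e \in E(G)$. Then $G - \{x,e\}$ has a $\Lambda$-factor. -/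

import Mathlib

namespace SimpleGraph

/-- `G` is `k`-connected: it has more than `k` vertices, and it stays connected after the deletion
of any set of fewer than `k` vertices. -/
def IsKConnected {V : Type*} [Fintype V] (G : SimpleGraph V) (k : ℕ) : Prop :=
  k < Fintype.card V ∧ ∀ S : Finset V, S.card < k → (G.induce {v : V | v ∉ S}).Connected

/-- `G` is claw-free: it has no induced subgraph isomorphic to `K_{1,3}`. -/
def IsClawFree {V : Type*} (G : SimpleGraph V) : Prop :=
  ¬ (completeBipartiteGraph (Fin 1) (Fin 3)).IsIndContained G

/-- `P` is an `H`-factor of `G`: a spanning subgraph of `G` (a graph on the same vertex set whose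
edges are edges of `G`) every connected component of which is isomorphic to `H`. -/
def IsFactor {V W : Type*} (H : SimpleGraph W) (P G : SimpleGraph V) : Prop :=
  P ≤ G ∧ ∀ C : P.ConnectedComponent, Nonempty (C.toSimpleGraph ≃g H)

/-- `G` has a `Λ`-factor, where `Λ` is the 3-vertex path. -/
def HasLambdaFactor {V : Type*} (G : SimpleGraph V) : Prop :=
  ∃ P : SimpleGraph V, IsFactor (pathGraph 3) P G

/-- `G - {x, e}`: delete the vertex `x` (with its incident edges) and the edge `e`
(keeping the ends of `e` other than `x`). -/
def deleteVertexEdge {V : Type*} (G : SimpleGraph V) (x : V) (e : Sym2 V) :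
    SimpleGraph {v : V | v ≠ x} :=
  (G.deleteEdges {e}).induce {v : V | v ≠ x}

end SimpleGraph

set_option linter.unusedSectionVars false

/-! Deleting `x` leaves a 2-connected claw-free graph whose order is divisible by 3. It must be
partitioned into 3-vertex paths that avoid one edge ab.

Splitting such a graph destroys 2-connectivity, so induction runs over chains: graphs that become
2-connected once two vertices s, t are joined. Claw-freeness keeps producing chains. Three pairwise
separated end-blocks with a common outside neighbour would give a claw, so removing a vertex from a
2-connected set leaves a chain (`TC.chain_erase`), and so do the sides of small cuts (`Piece.chain`
and its variants).

`fac_of_chain` partitions every claw-free chain of order divisible by 3. A cut vertex c has sides A,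
D with |A| + |D| ≡ 2 mod 3. If one residue is 2, c joins that side. If both are 1 and both sides are
large, each side is solved with a pendant vertex standing for the other, and the solutions are glued
along a path through c. If every cut has a one-vertex side, the set has pendant ends and
`TwoLeaf.fac` finds a splitting. `fac_of_tc` treats sets without a cut vertex.

For the edge ab (`fac_delete_of_tc`): if a and b have no common neighbour, removing ab creates no
claw and keeps a chain with ends a, b. Otherwise either a path a w b is used, w a common neighbour,
or a and b are put into different parts; the residues of the sides of a cut decide which. -/

namespace LambdaFactor

variable {V : Type*} {G : SimpleGraph V}

/-! ### Fragments, chains and local claw conditions -/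

/-- Every neighbour in `S \ P` of the set `P` is equal to `y`. -/
def Small (G : SimpleGraph V) (S P : Finset V) (y : V) : Prop :=
  ∀ u ∈ P, ∀ v ∈ S, v ∉ P → G.Adj u v → v = y

/-- `S` becomes 2-connected after joining `s` and `t`. -/
def Ch (G : SimpleGraph V) (S : Finset V) (s t : V) : Prop :=
  s ∈ S ∧ t ∈ S ∧ s ≠ t ∧ ∀ P ⊆ S, P.Nonempty → s ∉ P → t ∉ P → ∀ y, ¬ Small G S P y

/-- `S` induces a connected graph with at most two end-blocks. -/
def Chain (G : SimpleGraph V) (S : Finset V) : Prop := ∃ s t, Ch G S s t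

/-- A nonempty subset of `S` separated from another vertex of `S` by at most one vertex. -/
def Frag (G : SimpleGraph V) (S P : Finset V) : Prop :=
  P ⊆ S ∧ P.Nonempty ∧ ∃ y, Small G S P y ∧ ∃ z ∈ S, z ∉ P ∧ z ≠ y

/-- `S` induces a connected graph without cut vertices. -/
def TC (G : SimpleGraph V) (S : Finset V) : Prop := ∀ P, ¬ Frag G S P

def Conn (G : SimpleGraph V) (S : Finset V) : Prop :=
  ∀ P ⊆ S, P.Nonempty → P ≠ S → ∃ u ∈ P, ∃ v ∈ S, v ∉ P ∧ G.Adj u v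

/-- Disjoint sets without edges between them. -/
def Apart (G : SimpleGraph V) (P Q : Finset V) : Prop :=
  ∀ u ∈ P, ∀ v ∈ Q, u ≠ v ∧ ¬ G.Adj u v

def Touch (G : SimpleGraph V) (c : V) (P : Finset V) : Prop := ∃ u ∈ P, G.Adj c u

/-- The neighbours of `c` in `Y` form a clique. -/
def CliqueN (G : SimpleGraph V) (c : V) (Y : Finset V) : Prop :=
  ∀ u ∈ Y, ∀ v ∈ Y, u ≠ v → G.Adj c u → G.Adj c v → G.Adj u v

def ClawFreeOn (G : SimpleGraph V) (S : Finset V) : Prop :=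
  ∀ c ∈ S, ∀ a ∈ S, ∀ b ∈ S, ∀ d ∈ S, G.Adj c a → G.Adj c b → G.Adj c d →
    a ≠ b → a ≠ d → b ≠ d → G.Adj a b ∨ G.Adj a d ∨ G.Adj b d

theorem ClawFreeOn.mono {S T : Finset V} (h : ClawFreeOn G S) (hT : T ⊆ S) : ClawFreeOn G T :=
  fun c hc a ha b hb d hd => h c (hT hc) a (hT ha) b (hT hb) d (hT hd)

/-- Otherwise z, u, v would be the leaves of a claw at c. Typically z lies across a cut from Y. -/
theorem ClawFreeOn.cliqueN {S Y : Finset V} (h : ClawFreeOn G S) {c z : V} (hY : Y ⊆ S)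
    (hc : c ∈ S) (hz : z ∈ S) (hcz : G.Adj c z) (hzY : ∀ u ∈ Y, z ≠ u ∧ ¬ G.Adj z u) :
    CliqueN G c Y := by
  intro u hu v hv huv hcu hcv
  have := h c hc z hz u (hY hu) v (hY hv) hcz hcu hcv (hzY u hu).1 (hzY v hv).1 huv
  grind

theorem Apart.symm {P Q : Finset V} (h : Apart G P Q) : Apart G Q P :=
  fun u hu v hv => ⟨(h v hv u hu).1.symm, fun hh => (h v hv u hu).2 hh.symm⟩

section Decidable

variable [DecidableEq V]

/-! ### End-blocks as minimal fragments -/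

theorem exists_min_frag {S P : Finset V} (h : Frag G S P) :
    ∃ Q ⊆ P, Frag G S Q ∧ ∀ R ⊂ Q, ¬ Frag G S R := by
  induction P using Finset.strongInduction with
  | H P ih =>
    by_cases hm : ∀ R ⊂ P, ¬ Frag G S R
    · exact ⟨P, subset_rfl, h, hm⟩
    · push Not at hm
      obtain ⟨R, hR, hf⟩ := hm
      obtain ⟨Q, hQ, h1⟩ := ih R hR hf
      exact ⟨Q, hQ.trans hR.1, h1⟩

/-- Uncrossing: if P and Q met, P ∩ Q would be a fragment, so both would equal it by minimality.
Once they are disjoint, an edge between them would give p ∈ Q and q ∈ P. -/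
theorem apart_of_min_frag {S P Q : Finset V} (hS : Conn G S)
    (hP : Frag G S P) (hPm : ∀ R ⊂ P, ¬ Frag G S R)
    (hQ : Frag G S Q) (hQm : ∀ R ⊂ Q, ¬ Frag G S R) (hne : P ≠ Q) : Apart G P Q := by
  obtain ⟨hPS, hP0, p, hp, zp, hzp, hzp1, hzp2⟩ := hP
  obtain ⟨hQS, hQ0, q, hq, zq, hzq, hzq1, hzq2⟩ := hQ
  -- If it failed, no edge would leave P ∪ Q, so P ∪ Q = S, and S without P and p would be a
  -- fragment properly inside Q.
  have key : ¬ (p ∈ Q ∧ q ∈ P) := by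
    rintro ⟨h1, h2⟩
    have hU : P ∪ Q = S := by
      by_contra hU
      obtain ⟨u, hu, v, hv, hvn, huv⟩ := hS (P ∪ Q) (by grind) (hP0.mono (by grind)) hU
      have := hp u; have := hq u
      grind
    have hpP : p ∉ P := by
      intro hpP
      obtain ⟨u, hu, v, hv, hvn, huv⟩ := hS P hPS hP0 (by grind)
      have := hp u hu v hv hvn huv
      grind
    refine hQm (S \ insert p P) ⟨by grind, fun h => ?_⟩ ⟨by grind, ⟨zp, by grind⟩, p, ?_, ?_⟩
    · have := h h1; grind
    · intro u hu v hv hvn huv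
      have := hp v; have := huv.symm
      grind
    · obtain ⟨x, hx⟩ := hP0
      exact ⟨x, by grind⟩
  have key2 : Disjoint P Q := by
    by_contra hd
    rw [Finset.not_disjoint_iff] at hd
    obtain ⟨x, hxP, hxQ⟩ := hd
    have hfr : ∃ y, Small G S (P ∩ Q) y ∧ ∃ z ∈ S, z ∉ P ∩ Q ∧ z ≠ y := by
      by_cases h1 : p ∈ Q
      · refine ⟨p, ?_, zp, by grind⟩
        intro u hu v hv hvn huv
        have := hp u; have := hq u
        grind
      · refine ⟨q, ?_, zq, by grind⟩
        intro u hu v hv hvn huv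
        have := hp u; have := hq u
        grind
    have h1 : P ∩ Q = P := by
      by_contra hh
      exact hPm (P ∩ Q) (Finset.ssubset_iff_subset_ne.2 ⟨by grind, hh⟩)
        ⟨by grind, ⟨x, by grind⟩, hfr⟩
    have h2 : P ∩ Q = Q := by
      by_contra hh
      exact hQm (P ∩ Q) (Finset.ssubset_iff_subset_ne.2 ⟨by grind, hh⟩)
        ⟨by grind, ⟨x, by grind⟩, hfr⟩
    exact hne (h1.symm.trans h2)
  intro u hu v hv
  have hd := Finset.disjoint_left.1 key2
  refine ⟨by grind, fun huv => ?_⟩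
  have := hp u hu v (hQS hv); have := hq v hv u (hPS hu); have := huv.symm
  grind

/-- The ends s and t are taken from two distinct minimal fragments, or arbitrarily if there are
fewer. A fragment missing both would contain a third one. -/
theorem chain_of_frags {S : Finset V} (hS : Conn G S) (h2 : 2 ≤ S.card)
    (h : ∀ P₁ P₂ P₃, Frag G S P₁ → Frag G S P₂ → Frag G S P₃ →
      Apart G P₁ P₂ → Apart G P₁ P₃ → Apart G P₂ P₃ → False) : Chain G S := by
  have mk : ∀ s ∈ S, ∀ t ∈ S, s ≠ t → (∀ P, Frag G S P → s ∉ P → t ∈ P) → Chain G S := by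
    intro s hs t ht hst hP
    refine ⟨s, t, hs, ht, hst, fun P hPS hP0 hsP htP y hy => htP (hP P ⟨hPS, hP0, y, hy, ?_⟩ hsP)⟩
    by_cases hsy : s = y
    · exact ⟨t, ht, htP, by grind⟩
    · exact ⟨s, hs, hsP, hsy⟩
  have other : ∀ s ∈ S, ∃ t ∈ S, s ≠ t := by
    intro s hs
    obtain ⟨t, ht, hts⟩ := Finset.exists_mem_ne (by omega : 1 < S.card) s
    exact ⟨t, ht, hts.symm⟩
  by_cases hf : ∃ P, Frag G S P
  · obtain ⟨P, hP⟩ := hf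
    obtain ⟨P₁, -, hP₁, hm₁⟩ := exists_min_frag hP
    obtain ⟨s, hs⟩ := hP₁.2.1
    by_cases hf2 : ∃ P, Frag G S P ∧ s ∉ P
    · obtain ⟨P', hP', hsP'⟩ := hf2
      obtain ⟨P₂, hsub, hP₂, hm₂⟩ := exists_min_frag hP'
      obtain ⟨t, ht⟩ := hP₂.2.1
      refine mk s (hP₁.1 hs) t (hP₂.1 ht) (by grind) fun Q hQ hsQ => ?_
      by_contra htQ
      obtain ⟨P₃, hsub3, hP₃, hm₃⟩ := exists_min_frag hQ
      exact h P₁ P₂ P₃ hP₁ hP₂ hP₃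
        (apart_of_min_frag hS hP₁ hm₁ hP₂ hm₂ (by grind))
        (apart_of_min_frag hS hP₁ hm₁ hP₃ hm₃ (by grind))
        (apart_of_min_frag hS hP₂ hm₂ hP₃ hm₃ (by grind))
    · push Not at hf2
      obtain ⟨t, ht, hst⟩ := other s (hP₁.1 hs)
      exact mk s (hP₁.1 hs) t ht hst fun Q hQ hsQ => absurd (hf2 Q hQ) hsQ
  · push Not at hf
    obtain ⟨s, hs⟩ : S.Nonempty := by rw [← Finset.card_pos]; omega
    obtain ⟨t, ht, hst⟩ := other s hs
    exact mk s hs t ht hst fun Q hQ => absurd hQ (hf Q)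

/-- Pigeonhole: two of any three fragments share a type. In applications a type says that the
fragment contains a given vertex or meets a given clique. -/
theorem chain_of_two_types {S : Finset V} (hS : Conn G S) (h2 : 2 ≤ S.card)
    (τ₁ τ₂ : Finset V → Prop) (hτ : ∀ P, Frag G S P → τ₁ P ∨ τ₂ P)
    (h₁ : ∀ P Q, P ⊆ S → Q ⊆ S → Apart G P Q → τ₁ P → τ₁ Q → False)
    (h₂ : ∀ P Q, P ⊆ S → Q ⊆ S → Apart G P Q → τ₂ P → τ₂ Q → False) : Chain G S := by
  refine chain_of_frags hS h2 fun P₁ P₂ P₃ f₁ f₂ f₃ a₁₂ a₁₃ a₂₃ => ?_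
  have := hτ P₁ f₁; have := hτ P₂ f₂; have := hτ P₃ f₃
  have := h₁ P₁ P₂ f₁.1 f₂.1 a₁₂; have := h₁ P₁ P₃ f₁.1 f₃.1 a₁₃; have := h₁ P₂ P₃ f₂.1 f₃.1 a₂₃
  have := h₂ P₁ P₂ f₁.1 f₂.1 a₁₂; have := h₂ P₁ P₃ f₁.1 f₃.1 a₁₃; have := h₂ P₂ P₃ f₂.1 f₃.1 a₂₃
  tauto

theorem CliqueN.not_apart {c : V} {S P Q : Finset V} (h : CliqueN G c S) (hP : P ⊆ S) (hQ : Q ⊆ S)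
    (hPQ : Apart G P Q) (h1 : Touch G c P) (h2 : Touch G c Q) : False := by
  obtain ⟨u, hu, hcu⟩ := h1
  obtain ⟨v, hv, hcv⟩ := h2
  exact (hPQ u hu v hv).2 (h u (hP hu) v (hQ hv) (hPQ u hu v hv).1 hcu hcv)

/-- A connectivity criterion by bipartitions. -/
theorem conn_of_apart {S : Finset V}
    (h : ∀ P Q, P ⊆ S → Q ⊆ S → (∀ v ∈ S, v ∈ P ∨ v ∈ Q) → P.Nonempty → Q.Nonempty →
      Apart G P Q → False) : Conn G S := by
  intro P hPS hP0 hne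
  by_contra hcon
  push Not at hcon
  refine h P (S \ P) hPS (by grind) (by grind) hP0 ?_ ?_
  · rw [Finset.sdiff_nonempty]; exact fun hh => hne (Finset.Subset.antisymm hPS hh)
  · intro u hu v hv
    have := hcon u hu v
    grind

/-- A fragment without a neighbour of x would already be a fragment of B. -/
theorem TC.touch_of_frag {B P : Finset V} {x : V} (hB : TC G B)
    (h : Frag G (B.erase x) P) : Touch G x P := by
  obtain ⟨hPS, hP0, y, hy, z, hz⟩ := h
  by_contra ht
  refine hB P ⟨by grind, hP0, y, ?_, z, by grind⟩
  intro u hu v hv hvP huv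
  have := hy u hu v
  have : v ≠ x := by rintro rfl; exact ht ⟨u, hu, huv.symm⟩
  grind

/-- Three pairwise apart fragments would contain the leaves of a claw at x. -/
theorem TC.chain_erase {B : Finset V} (hB : TC G B) (hc : ClawFreeOn G B) (h3 : 3 ≤ B.card)
    {x : V} (hx : x ∈ B) : Chain G (B.erase x) := by
  have hcard := Finset.card_erase_of_mem hx
  refine chain_of_frags ?_ (by omega) ?_
  · refine conn_of_apart fun P Q hPS hQS hPQ hP hQ hap => ?_
    refine hB P ⟨by grind, hP, x, ?_, ?_⟩
    · intro u hu v hv hvP huv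
      by_contra hvx
      exact (hap u hu v (by grind)).2 huv
    · obtain ⟨z, hz⟩ := hQ
      have := (hap · · z hz)
      exact ⟨z, by grind⟩
  · intro P₁ P₂ P₃ f₁ f₂ f₃ a₁₂ a₁₃ a₂₃
    obtain ⟨u₁, hu₁, h₁⟩ := hB.touch_of_frag f₁
    obtain ⟨u₂, hu₂, h₂⟩ := hB.touch_of_frag f₂
    obtain ⟨u₃, hu₃, h₃⟩ := hB.touch_of_frag f₃
    have m₁ := f₁.1 hu₁; have m₂ := f₂.1 hu₂; have m₃ := f₃.1 hu₃
    have q₁ := a₁₂ u₁ hu₁ u₂ hu₂; have q₂ := a₁₃ u₁ hu₁ u₃ hu₃; have q₃ := a₂₃ u₂ hu₂ u₃ hu₃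
    have := hc x hx u₁ (by grind) u₂ (by grind) u₃ (by grind) h₁ h₂ h₃ q₁.1 q₂.1 q₃.1
    tauto

/-! ### Sides of two-vertex cuts -/

/-- `{x, c}` separates `Y` from the rest, and no single vertex separates a part of `Y`
from `{x, c}`. -/
def Piece (G : SimpleGraph V) (Y : Finset V) (x c : V) : Prop :=
  x ∉ Y ∧ c ∉ Y ∧ x ≠ c ∧
    ∀ P ⊆ Y, P.Nonempty → ∀ y, ¬ Small G (insert x (insert c Y)) P y

theorem Piece.symm {Y : Finset V} {x c : V} (h : Piece G Y x c) : Piece G Y c x :=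
  ⟨h.2.1, h.1, h.2.2.1.symm, by rw [Finset.insert_comm]; exact h.2.2.2⟩

theorem Piece.ch {Y : Finset V} {x c : V} (h : Piece G Y x c) :
    Ch G (insert x (insert c Y)) x c := by
  obtain ⟨h1, h2, h3, h4⟩ := h
  refine ⟨by grind, by grind, h3, fun P hPS hP0 hx hc y => h4 P ?_ hP0 y⟩
  grind

/-- Here P is a union of components of Y; if it missed c, its only exit would be x. -/
theorem Piece.touch {Y P : Finset V} {x c : V} (h : Piece G Y x c) (hP : P ⊆ Y)
    (hP0 : P.Nonempty) (hcl : ∀ u ∈ P, ∀ v ∈ Y, v ∉ P → ¬ G.Adj u v) : Touch G c P := by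
  by_contra hc
  refine h.2.2.2 P hP hP0 x fun u hu v hv hvP huv => ?_
  have := hcl u hu v
  have : v ≠ c := by rintro rfl; exact hc ⟨u, hu, huv.symm⟩
  grind

/-- One end is x, the other lies in the clique of neighbours of c: a fragment that avoids both has a
single exit in the whole piece. -/
theorem Piece.chain_insert {Y : Finset V} {x c : V} (h : Piece G Y x c) (h0 : Y.Nonempty)
    (hc : CliqueN G c Y) : Chain G (insert x Y) := by
  obtain ⟨h1, h2, h3, h4⟩ := id h
  refine chain_of_two_types (τ₁ := fun P => x ∈ P) (τ₂ := fun P => x ∉ P ∧ Touch G c P)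
    ?_ ?_ ?_ ?_ ?_
  · refine conn_of_apart fun P Q hPS hQS hPQ hP hQ hap => ?_
    have key : ∀ P Q, P ⊆ insert x Y → (∀ v ∈ insert x Y, v ∈ P ∨ v ∈ Q) → P.Nonempty →
        Apart G P Q → x ∉ P → False := by
      intro P Q hPS hPQ hP hap hx
      refine h4 P (by grind) hP c fun u hu v hv hvP huv => ?_
      by_contra hvc
      exact (hap u hu v (by grind)).2 huv
    by_cases hx : x ∈ P
    · exact key Q P hQS (by grind) hQ hap.symm fun hxQ => (hap x hx x hxQ).1 rfl
    · exact key P Q hPS hPQ hP hap hx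
  · rw [Finset.card_insert_of_notMem h1]; have := h0.card_pos; omega
  · rintro P ⟨hPS, hP0, y, hy, -⟩
    by_contra hcon
    push Not at hcon
    refine h4 P (by grind) hP0 y fun u hu v hv hvP huv => ?_
    have : v ≠ c := by rintro rfl; exact hcon.2 hcon.1 ⟨u, hu, huv.symm⟩
    exact hy u hu v (by grind) hvP huv
  · intro P Q _ _ hap hP hQ
    exact (hap x hP x hQ).1 rfl
  · intro P Q hPS hQS hap hP hQ
    exact hc.not_apart (by grind) (by grind) hap hP.2 hQ.2

theorem Piece.chain {Y : Finset V} {x c : V} (h : Piece G Y x c) (h0 : 2 ≤ Y.card)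
    (hx : CliqueN G x Y) (hc : CliqueN G c Y) : Chain G Y := by
  obtain ⟨h1, h2, h3, h4⟩ := id h
  refine chain_of_two_types (τ₁ := fun P => Touch G x P) (τ₂ := fun P => Touch G c P)
    ?_ h0 ?_ ?_ ?_
  · refine conn_of_apart fun P Q hPS hQS hPQ hP hQ hap => ?_
    exact hc.not_apart hPS hQS hap
      (h.touch hPS hP fun u hu v hv hvP => (hap u hu v (by grind)).2)
      (h.touch hQS hQ fun u hu v hv hvP => (hap.symm u hu v (by grind)).2)
  · rintro P ⟨hPS, hP0, y, hy, -⟩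
    by_contra hcon
    push Not at hcon
    refine h4 P (by grind) hP0 y fun u hu v hv hvP huv => ?_
    have : v ≠ c := by rintro rfl; exact hcon.2 ⟨u, hu, huv.symm⟩
    have : v ≠ x := by rintro rfl; exact hcon.1 ⟨u, hu, huv.symm⟩
    exact hy u hu v (by grind) hvP huv
  · exact fun P Q hPS hQS hap hP hQ => hx.not_apart hPS hQS hap hP hQ
  · exact fun P Q hPS hQS hap hP hQ => hc.not_apart hPS hQS hap hP hQ

/-- If y ∈ P, the single exit is the pendant vertex x. Then either Y ⊆ P, and c has a neighbour in
P, or c is the only exit of Y \ P. -/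
theorem Piece.not_small_of_leaf {Y P : Finset V} {x y c : V} (h : Piece G Y y c) (h0 : Y.Nonempty)
    (hxy : G.Adj x y) (hxY : x ∉ Y) (hxc : x ≠ c)
    (hP : P ⊆ insert y Y) (hP0 : P.Nonempty)
    (hnc : ∀ u ∈ P, u ∈ Y → ¬ G.Adj c u) (w : V) : ¬ Small G (insert x (insert y Y)) P w := by
  obtain ⟨h1, h2, h3, h4⟩ := id h
  intro hw
  have hx := hxy.ne
  by_cases hy : y ∈ P
  · have hwx : x = w := hw y hy x (by grind) (by grind) hxy.symm
    subst hwx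
    by_cases hYP : Y ⊆ P
    · obtain ⟨u, hu, hcu⟩ := h.touch subset_rfl h0 (by grind)
      exact hnc u (hYP hu) hu hcu
    · refine h4 (Y \ P) (by grind) (Finset.sdiff_nonempty.2 hYP) c fun u hu v hv hvP huv => ?_
      have := hw v; have := huv.symm
      grind
  · refine h4 P (by grind) hP0 w fun u hu v hv hvP huv => ?_
    have : v ≠ c := by rintro rfl; exact hnc u hu (by grind) huv.symm
    exact hw u hu v (by grind) hvP huv

/-- The pendant vertex x takes over from y the role of an end. -/
theorem Piece.ch_leaf {Y : Finset V} {x y c : V} (h : Piece G Y y c) (h0 : Y.Nonempty)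
    (hxy : G.Adj x y) (hxY : x ∉ Y) (hxc : x ≠ c) :
    Ch G (insert x (insert y (insert c Y))) c x := by
  obtain ⟨h1, h2, h3, h4⟩ := id h
  refine ⟨by grind, by grind, hxc.symm, fun P hPS hP0 hc hx w hw => ?_⟩
  have hx := hxy.ne
  by_cases hn : ∀ u ∈ P, u ∈ Y → ¬ G.Adj c u
  · refine h.not_small_of_leaf h0 hxy hxY hxc (P := P) (by grind) hP0 hn w ?_
    intro u hu v hv
    exact hw u hu v (by grind)
  · push Not at hn
    obtain ⟨u, hu, huY, hcu⟩ := hn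
    have hwc : c = w := hw u hu c (by grind) hc hcu.symm
    subst hwc
    by_cases hy : y ∈ P
    · have := hw y hy x (by grind) (by grind) hxy.symm
      grind
    · exact h4 P (by grind) hP0 c fun u hu v hv => hw u hu v (by grind)

theorem Piece.chain_leaf {Y : Finset V} {x y c : V} (h : Piece G Y y c) (h0 : Y.Nonempty)
    (hxy : G.Adj x y) (hxY : x ∉ Y) (hxc : x ≠ c) (hc : CliqueN G c Y) :
    Chain G (insert x (insert y Y)) := by
  obtain ⟨h1, h2, h3, h4⟩ := id h
  have hx := hxy.ne
  refine chain_of_two_types (τ₁ := fun P => x ∈ P) (τ₂ := fun P => Touch G c (P ∩ Y))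
    ?_ ?_ ?_ ?_ ?_
  · refine conn_of_apart fun P Q hPS hQS hPQ hP hQ hap => ?_
    have key : ∀ P Q, P ⊆ insert x (insert y Y) → (∀ v ∈ insert x (insert y Y), v ∈ P ∨ v ∈ Q) →
        P.Nonempty → Apart G P Q → x ∉ P → False := by
      intro P Q hPS hPQ hP hap hx
      have hy : y ∉ P := fun hy => (hap y hy x (by grind)).2 hxy.symm
      refine h4 P (by grind) hP c fun u hu v hv hvP huv => ?_
      by_contra hvc
      exact (hap u hu v (by grind)).2 huv
    by_cases hx : x ∈ P
    · exact key Q P hQS (by grind) hQ hap.symm fun hxQ => (hap x hx x hxQ).1 rfl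
    · exact key P Q hPS hPQ hP hap hx
  · rw [Finset.card_insert_of_notMem (by grind), Finset.card_insert_of_notMem (by grind)]; omega
  · rintro P ⟨hPS, hP0, w, hw, -⟩
    by_contra hcon
    push Not at hcon
    refine h.not_small_of_leaf h0 hxy hxY hxc (P := P) (by grind) hP0 ?_ w hw
    exact fun u hu huY hcu => hcon.2 ⟨u, by grind, hcu⟩
  · intro P Q _ _ hap hP hQ
    exact (hap x hP x hQ).1 rfl
  · intro P Q hPS hQS hap hP hQ
    refine hc.not_apart (P := P ∩ Y) (Q := Q ∩ Y) (by grind) (by grind) ?_ hP hQ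
    exact fun u hu v hv => hap u (by grind) v (by grind)

/-! ### Partitions into 3-vertex paths -/

/-- `S` can be partitioned into vertex sets of 3-vertex paths. -/
inductive Fac (G : SimpleGraph V) : Finset V → Prop
  | empty : Fac G ∅
  | step (S : Finset V) (u v w : V) : u ∉ S → v ∉ S → w ∉ S → u ≠ w → G.Adj u v → G.Adj v w →
      Fac G S → Fac G (insert u (insert v (insert w S)))

theorem Fac.of_sdiff {S : Finset V} {u v w : V} (hu : u ∈ S) (hv : v ∈ S) (hw : w ∈ S)
    (huw : u ≠ w) (huv : G.Adj u v) (hvw : G.Adj v w) (h : Fac G (S \ {u, v, w})) : Fac G S := by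
  have := Fac.step _ u v w (by grind) (by grind) (by grind) huw huv hvw h
  convert this using 1
  ext x
  by_cases x = u <;> by_cases x = v <;> by_cases x = w <;> grind

theorem Fac.union {S T : Finset V} (hS : Fac G S) (hT : Fac G T) (h : Disjoint S T) :
    Fac G (S ∪ T) := by
  induction hS with
  | empty => simpa
  | step S u v w hu hv hw huw huv hvw hS ih =>
    rw [Finset.disjoint_left] at h
    have h' := ih (by rw [Finset.disjoint_left]; grind)
    have := Fac.step _ u v w (by grind) (by grind) (by grind) huw huv hvw h'
    simpa [Finset.insert_union] using this

theorem Fac.of_split {S A B : Finset V} (hA : Fac G A) (hB : Fac G B)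
    (h : ∀ v, v ∈ S ↔ v ∈ A ∨ v ∈ B) (hd : ∀ v ∈ A, v ∉ B) : Fac G S := by
  have := hA.union hB (Finset.disjoint_left.2 hd)
  convert this using 1
  ext; grind

/-- If the only neighbour of `b` is `c`, then the path through `b` is `b c a`. -/
theorem Fac.exists_of_leaf {S : Finset V} {b c : V} (hS : Fac G S) (hb : b ∈ S)
    (hbc : ∀ v ∈ S, G.Adj b v → v = c) :
    ∃ a ∈ S, G.Adj c a ∧ a ≠ b ∧ c ∈ S ∧ G.Adj b c ∧ Fac G (S \ {a, b, c}) := by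
  induction hS with
  | empty => simp at hb
  | step S u v w hu hv hw huw huv hvw hS ih =>
    have e1 := huv.ne
    have e2 := hvw.ne
    by_cases hbS : b ∈ S
    · obtain ⟨a, ha, hca, hab, hc, hbc', hf⟩ := ih hbS fun v hv => hbc v (by grind)
      refine ⟨a, by grind, hca, hab, by grind, hbc', ?_⟩
      have := Fac.step _ u v w (by grind) (by grind) (by grind) huw huv hvw hf
      convert this using 1
      clear this hf ih
      ext x
      simp only [Finset.mem_sdiff, Finset.mem_insert, Finset.mem_singleton]
      by_cases x = u <;> by_cases x = v <;> by_cases x = w <;> grind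
    · have hSe : ∀ a b c, ({a, b, c} : Finset V) = {u, v, w} →
          insert u (insert v (insert w S)) \ {a, b, c} = S := by
        intro a b c h; rw [h]; ext x; grind
      -- The middle vertex of a path has two neighbours, so b is an end of the new path.
      have hvb : v ≠ b := by
        rintro rfl
        have := hbc u (by grind) huv.symm
        have := hbc w (by grind) hvw
        grind
      by_cases hub : u = b
      · subst hub
        have := hbc v (by grind) huv
        subst this
        refine ⟨w, by grind, hvw, huw.symm, by grind, huv, ?_⟩
        rw [hSe _ _ _ (by ext; grind)]; exact hS
      · have hwb : w = b := by grind
        subst hwb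
        have := hbc v (by grind) hvw.symm
        subst this
        refine ⟨u, by grind, huv.symm, huw, by grind, hvw.symm, ?_⟩
        rw [hSe _ _ _ (by ext; grind)]; exact hS

/-! ### Cut vertices of chains -/

/-- `c` separates `A` from `D` in `S`. -/
def Cut (G : SimpleGraph V) (S : Finset V) (c : V) (A D : Finset V) : Prop :=
  (∀ v, v ∈ S ↔ v = c ∨ v ∈ A ∨ v ∈ D) ∧ c ∉ A ∧ c ∉ D ∧ Apart G A D ∧ A.Nonempty ∧ D.Nonempty

theorem Cut.symm {S A D : Finset V} {c : V} (h : Cut G S c A D) : Cut G S c D A :=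
  ⟨by have := h.1; grind, h.2.2.1, h.2.1, h.2.2.2.1.symm, h.2.2.2.2.2, h.2.2.2.2.1⟩

theorem Cut.card {S A D : Finset V} {c : V} (h : Cut G S c A D) :
    S.card = A.card + D.card + 1 := by
  obtain ⟨h1, h2, h3, h4, -, -⟩ := h
  have : S = insert c (A ∪ D) := by ext; grind
  rw [this, Finset.card_insert_of_notMem (by grind), Finset.card_union_of_disjoint]
  rw [Finset.disjoint_left]
  exact fun v hv hv' => (h4 v hv v hv').1 rfl

theorem Ch.symm {S : Finset V} {s t : V} (h : Ch G S s t) : Ch G S t s :=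
  ⟨h.2.1, h.1, h.2.2.1.symm, fun P h1 h2 h3 h4 => h.2.2.2 P h1 h2 h4 h3⟩

/-- The size bound matters: two nonadjacent vertices satisfy `Ch` vacuously. -/
theorem Ch.conn {S : Finset V} {s t : V} (h : Ch G S s t) (h3 : 3 ≤ S.card) : Conn G S := by
  obtain ⟨hs, ht, hst, h4⟩ := h
  obtain ⟨v, hv⟩ : (S \ {s, t}).Nonempty := by
    rw [← Finset.card_pos]
    have := Finset.le_card_sdiff {s, t} S
    have := Finset.card_le_two (a := s) (b := t)
    omega
  have key : ∀ P Q, P ⊆ S → Q ⊆ S → (∀ v ∈ S, v ∈ P ∨ v ∈ Q) → Apart G P Q → v ∈ P →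
      Q.Nonempty → False := by
    intro P Q hPS hQS hPQ hap hvP hQ
    by_cases hsP : s ∈ P
    · by_cases htP : t ∈ P
      · refine h4 Q hQS hQ ?_ ?_ s ?_
        · exact fun h => (hap s hsP s h).1 rfl
        · exact fun h => (hap t htP t h).1 rfl
        · intro u hu w hw hwQ huw
          exact absurd huw.symm (hap w (by grind) u hu).2
      · refine h4 (P.erase s) (by grind) ⟨v, by grind⟩ (by grind) (by grind) s ?_
        intro u hu w hw hwQ huw
        have := hap u (by grind) w
        grind
    · refine h4 (P.erase t) (by grind) ⟨v, by grind⟩ (by grind) (by grind) t ?_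
      intro u hu w hw hwQ huw
      have := hap u (by grind) w
      grind
  refine conn_of_apart fun P Q hPS hQS hPQ hP hQ hap => ?_
  rcases hPQ v (by grind) with hv | hv
  · exact key P Q hPS hQS hPQ hap hv hQ
  · exact key Q P hQS hPS (by grind) hap.symm hv hP

theorem Chain.conn {S : Finset V} (h : Chain G S) (h3 : 3 ≤ S.card) : Conn G S := by
  obtain ⟨s, t, h⟩ := h; exact h.conn h3

theorem TC.conn {S : Finset V} (h : TC G S) : Conn G S := by
  refine conn_of_apart fun P Q hPS hQS hPQ hP hQ hap => ?_
  obtain ⟨y, hy⟩ := id hP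
  obtain ⟨z, hz⟩ := hQ
  have := hap y hy z hz
  refine h P ⟨hPS, hP, y, ?_, z, hQS hz, fun hzP => (hap z hzP z hz).1 rfl, this.1.symm⟩
  intro u hu w hw hwQ huw
  exact absurd huw (hap u hu w (by grind)).2

theorem Frag.cut {S P : Finset V} (hS : Conn G S) (h : Frag G S P) : ∃ c D, Cut G S c P D := by
  obtain ⟨hPS, hP0, y, hy, z, hz, hzP, hzy⟩ := h
  obtain ⟨u, hu, v, hv, hvP, huv⟩ := hS P hPS hP0 (by grind)
  have hvy := hy u hu v hv hvP huv
  subst hvy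
  refine ⟨v, S \ insert v P, by grind, hvP, by grind, ?_, hP0, z, by grind⟩
  intro u hu w hw
  have := hy u hu w
  grind

theorem exists_cut {S : Finset V} (hS : Conn G S) (h : ¬ TC G S) : ∃ c A D, Cut G S c A D := by
  unfold TC at h
  push Not at h
  obtain ⟨P, hP⟩ := h
  obtain ⟨c, D, h⟩ := hP.cut hS
  exact ⟨c, P, D, h⟩

theorem Cut.touch {S A D : Finset V} {c : V} (h : Cut G S c A D) (hS : Conn G S) :
    Touch G c A := by
  obtain ⟨h1, h2, h3, h4, h5, h6⟩ := h
  obtain ⟨z, hz⟩ := h6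
  obtain ⟨u, hu, v, hv, hvP, huv⟩ := hS A (by grind) h5 (by have := fun u hu => h4 u hu z hz; grind)
  have := h4 u hu v
  have : v = c := by grind
  exact ⟨u, hu, this ▸ huv.symm⟩

theorem Cut.cliqueN {S A D : Finset V} {c : V} (h : Cut G S c A D) (hS : Conn G S)
    (hc : ClawFreeOn G S) : CliqueN G c A := by
  obtain ⟨z, hz, hcz⟩ := h.symm.touch hS
  obtain ⟨h1, h2, h3, h4, h5, h6⟩ := h
  exact hc.cliqueN (by grind) (by grind) (by grind) hcz fun u hu => h4.symm z hz u hu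

/-- A side containing neither end would have c as its only exit. -/
theorem Cut.ends {S A D : Finset V} {c s t : V} (h : Cut G S c A D) (hS : Ch G S s t) :
    (s ∈ A ∧ t ∈ D) ∨ (t ∈ A ∧ s ∈ D) := by
  have key : ∀ A D, Cut G S c A D → s ∈ A ∨ t ∈ A := by
    intro A D h
    obtain ⟨h1, h2, h3, h4, h5, h6⟩ := h
    by_contra hcon
    push Not at hcon
    refine hS.2.2.2 A (by grind) h5 hcon.1 hcon.2 c fun u hu v hv hvP huv => ?_
    have := h4 u hu v
    grind
  have h1 := key A D h
  have h2 := key D A h.symm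
  obtain ⟨-, -, -, h4, -, -⟩ := h
  have := fun h => h4 s h s; have := fun h => h4 t h t
  tauto

theorem Cut.piece {S A D : Finset V} {c s t : V} (h : Cut G S c A D) (hS : Ch G S s t)
    (hs : s ∈ A) (ht : t ∈ D) : Piece G (A.erase s) s c := by
  obtain ⟨h1, h2, h3, h4, h5, h6⟩ := h
  refine ⟨by grind, by grind, by grind, fun P hPA hP y hy => ?_⟩
  refine hS.2.2.2 P (by grind) hP (by grind) ?_ y fun u hu v hv hvP huv => ?_
  · intro htP
    exact (h4 t (by grind) t ht).1 rfl
  · have := h4 u (by grind) v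
    exact hy u hu v (by grind) hvP huv

theorem Cut.exists_piece {S A D : Finset V} {c : V} (h : Cut G S c A D) (hS : Chain G S) :
    ∃ s ∈ A, Piece G (A.erase s) s c := by
  obtain ⟨s, t, hS⟩ := hS
  rcases h.ends hS with h1 | h1
  · exact ⟨s, h1.1, h.piece hS h1.1 h1.2⟩
  · exact ⟨t, h1.1, h.piece hS.symm h1.1 h1.2⟩

theorem Cut.card_three_le {S A D : Finset V} {c : V} (h : Cut G S c A D) : 3 ≤ S.card := by
  have := h.card
  have := h.2.2.2.2.1.card_pos
  have := h.2.2.2.2.2.card_pos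
  omega

theorem Cut.chain_side {S A D : Finset V} {c : V} (h : Cut G S c A D) (hS : Chain G S)
    (hc : ClawFreeOn G S) (h2 : 2 ≤ A.card) : Chain G A := by
  obtain ⟨s, hs, hp⟩ := h.exists_piece hS
  have := Finset.card_erase_of_mem hs
  have hq := h.cliqueN (hS.conn h.card_three_le) hc
  have := hp.chain_insert (by rw [← Finset.card_pos]; omega)
    (fun u hu v hv => hq u (by grind) v (by grind))
  rwa [Finset.insert_erase hs] at this

theorem Cut.chain_insert {S A D : Finset V} {c : V} (h : Cut G S c A D) (hS : Chain G S) :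
    Chain G (insert c A) := by
  obtain ⟨s, hs, hp⟩ := h.exists_piece hS
  have := hp.ch
  rw [Finset.insert_comm, Finset.insert_erase hs] at this
  exact ⟨_, _, this⟩

theorem Cut.chain_insert_leaf {S A D : Finset V} {b c : V} (h : Cut G S c A D) (hS : Chain G S)
    (h2 : 2 ≤ A.card) (hb : b ∈ D) (hbc : G.Adj b c) : Chain G (insert b (insert c A)) := by
  obtain ⟨s, hs, hp⟩ := h.exists_piece hS
  have := Finset.card_erase_of_mem hs
  have hap := h.2.2.2.1.symm b hb
  have := hp.symm.ch_leaf (x := b) (by rw [← Finset.card_pos]; omega) hbc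
    (fun hh => (hap b (by grind)).1 rfl) (hap s hs).1
  rw [Finset.insert_erase hs] at this
  exact ⟨_, _, this⟩

theorem TC.piece {S A D : Finset V} {x c : V} (hS : TC G S) (hx : x ∈ S)
    (h : Cut G (S.erase x) c A D) : Piece G A x c := by
  obtain ⟨h1, h2, h3, h4, h5, h6⟩ := h
  refine ⟨by grind, h2, by grind, fun P hPA hP y hy => hS P ⟨by grind, hP, y, ?_, ?_⟩⟩
  · intro u hu v hv hvP huv
    have := h4 u (by grind) v
    exact hy u hu v (by grind) hvP huv
  · by_cases hxy : x = y
    · exact ⟨c, by grind⟩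
    · exact ⟨x, by grind⟩

theorem TC.touch {S A D : Finset V} {x c : V} (hS : TC G S) (hx : x ∈ S)
    (h : Cut G (S.erase x) c A D) : Touch G x A :=
  (hS.piece hx h).symm.touch subset_rfl h.2.2.2.2.1 (by grind)

theorem TC.cliqueN {S A D : Finset V} {x c : V} (hS : TC G S) (hc : ClawFreeOn G S) (hx : x ∈ S)
    (h : Cut G (S.erase x) c A D) : CliqueN G x A := by
  obtain ⟨z, hz, hcz⟩ := hS.touch hx h.symm
  obtain ⟨h1, h2, h3, h4, h5, h6⟩ := h
  exact hc.cliqueN (by grind) (by grind) (by grind) hcz fun u hu => h4.symm z hz u hu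

theorem TC.cliqueN' {S A D : Finset V} {x c : V} (hS : TC G S) (hc : ClawFreeOn G S) (hx : x ∈ S)
    (h : Cut G (S.erase x) c A D) : CliqueN G c A := by
  obtain ⟨z, hz, hcz⟩ := (hS.piece hx h.symm).touch subset_rfl h.2.2.2.2.2 (by grind)
  obtain ⟨h1, h2, h3, h4, h5, h6⟩ := h
  exact hc.cliqueN (S := S) (by grind) (by grind) (by grind) hcz fun u hu => h4.symm z hz u hu

theorem three_dvd_nonempty {S : Finset V} (h : 3 ∣ S.card) (h0 : S.Nonempty) : 3 ≤ S.card :=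
  Nat.le_of_dvd h0.card_pos h

theorem fac_of_card_three {S : Finset V} (hS : Chain G S) (h3 : S.card = 3) : Fac G S := by
  obtain ⟨s, t, hs, ht, hst, h⟩ := hS
  obtain ⟨v, hv⟩ : (S \ {s, t}).Nonempty := by
    rw [← Finset.card_pos]
    have := Finset.le_card_sdiff {s, t} S
    have := Finset.card_le_two (a := s) (b := t)
    omega
  have hsub : {s, v, t} ⊆ S := by grind
  have hSe : S = {s, v, t} := by
    refine (Finset.eq_of_subset_of_card_le hsub ?_).symm
    rw [h3, Finset.card_eq_three.2 ⟨s, v, t, by grind, by grind, by grind, rfl⟩]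
  have key : ∀ s t, s ∈ S → t ∈ S → S = {s, v, t} → s ≠ v → t ≠ v → (∀ y, ¬ Small G S {v} y) →
      G.Adj s v := by
    intro s t hs ht hSe hsv htv h
    by_contra hcon
    refine h t fun u hu w hw hwv huw => ?_
    have := huw.symm
    grind
  have hsm := h {v} (by grind) (by simp) (by grind) (by grind)
  refine Fac.of_sdiff hs (v := v) (by grind) ht hst
    (key s t hs ht hSe (by grind) (by grind) hsm)
    (key t s ht hs (by rw [hSe]; ext; grind) (by grind) (by grind) hsm).symm ?_
  rw [hSe, Finset.sdiff_self]
  exact .empty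

/-! ### Splitting by residues modulo 3 -/

theorem Fac.of_card_split {S A B : Finset V}
    (ih : ∀ T ⊂ S, 3 ∣ T.card → (T.Nonempty → Chain G T) → Fac G T)
    (h3 : 3 ∣ S.card) (hA : A.Nonempty) (hB : B.Nonempty) (hAB : ∀ v, v ∈ S ↔ v ∈ A ∨ v ∈ B)
    (hd : ∀ v ∈ A, v ∉ B) (hA3 : 3 ∣ A.card) (hAc : 3 ≤ A.card → Chain G A)
    (hBc : 3 ≤ B.card → Chain G B) : Fac G S := by
  have hcard : S.card = A.card + B.card := by
    rw [← Finset.card_union_of_disjoint (Finset.disjoint_left.2 hd)]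
    congr 1; ext; grind
  have hB3 : 3 ∣ B.card := by omega
  refine (ih A ?_ hA3 fun h0 => hAc (three_dvd_nonempty hA3 h0)).of_split
    (ih B ?_ hB3 fun h0 => hBc (three_dvd_nonempty hB3 h0)) hAB hd
  · obtain ⟨z, hz⟩ := hB
    rw [Finset.ssubset_iff_of_subset (by grind)]
    exact ⟨z, by grind⟩
  · obtain ⟨z, hz⟩ := hA
    rw [Finset.ssubset_iff_of_subset (by grind)]
    exact ⟨z, by grind⟩

section Induction

variable {S : Finset V} (ih : ∀ T ⊂ S, 3 ∣ T.card → (T.Nonempty → Chain G T) → Fac G T)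
include ih

theorem fac_of_cut_two_mod {A D : Finset V} {c : V} (hS : Chain G S) (hc : ClawFreeOn G S)
    (h3 : 3 ∣ S.card) (h : Cut G S c A D) (hA : A.card % 3 = 2) : Fac G S := by
  have hcard := h.card
  have hD3 : 3 ∣ D.card := by omega
  obtain ⟨h1, h2, h3', h4, h5, h6⟩ := id h
  refine Fac.of_split (A := insert c A) (B := D) (ih _ ?_ ?_ fun _ => h.chain_insert hS)
    (ih _ ?_ hD3 fun h0 => h.symm.chain_side hS hc (by have := three_dvd_nonempty hD3 h0; omega))
    (by grind) ?_
  · rw [Finset.ssubset_iff_of_subset (by grind)]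
    obtain ⟨z, hz⟩ := h6
    exact ⟨z, by grind, by have := h4.symm z hz z; grind⟩
  · rw [Finset.card_insert_of_notMem h2]; omega
  · rw [Finset.ssubset_iff_of_subset (by grind)]
    exact ⟨c, by grind⟩
  · intro v hv hvD
    have := h4.symm v hvD v
    grind

/-- One pendant neighbour of c replaces the side D. The smaller set has order divisible by 3, and
its partition has a path from the pendant vertex through c to some a ∈ A, so A - a is partitioned.
Symmetrically for D; a path through c joins the two leftover vertices. -/
theorem fac_of_cut_of_one_lt {A D : Finset V} {c : V} (hS : Chain G S)
    (h : Cut G S c A D) (hA : A.card % 3 = 1) (hD : D.card % 3 = 1)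
    (hA1 : 1 < A.card) (hD1 : 1 < D.card) : Fac G S := by
  have hconn := hS.conn h.card_three_le
  have key : ∀ A D, Cut G S c A D → A.card % 3 = 1 → D.card % 3 = 1 → 1 < A.card → 1 < D.card →
      ∃ a ∈ A, G.Adj c a ∧ Fac G (A.erase a) := by
    intro A D h hA hD hA1 hD1
    obtain ⟨b, hb, hcb⟩ := h.symm.touch hconn
    obtain ⟨h1, h2, h3, h4, h5, h6⟩ := id h
    have hbA : b ∉ A := fun hbA => (h4 b hbA b hb).1 rfl
    have hf : Fac G (insert b (insert c A)) := by
      refine ih _ ?_ ?_ fun _ => h.chain_insert_leaf hS (by omega) hb hcb.symm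
      · rw [Finset.ssubset_iff_of_subset (by grind)]
        obtain ⟨z, hz, hzb⟩ := Finset.exists_mem_ne hD1 b
        exact ⟨z, by grind, by have := h4.symm z hz z; grind⟩
      · rw [Finset.card_insert_of_notMem (by grind), Finset.card_insert_of_notMem h2]; omega
    obtain ⟨a, ha, hca, hab, -, -, hf⟩ := hf.exists_of_leaf (b := b) (c := c) (by grind) (by
      intro v hv hbv
      have := h4.symm b hb v
      have := hbv.ne
      grind)
    have := hca.ne
    refine ⟨a, by grind, hca, ?_⟩
    convert hf using 1
    ext v
    grind
  obtain ⟨a, ha, hca, hfA⟩ := key A D h hA hD hA1 hD1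
  obtain ⟨b, hb, hcb, hfD⟩ := key D A h.symm hD hA hD1 hA1
  obtain ⟨h1, h2, h3, h4, h5, h6⟩ := id h
  refine Fac.of_sdiff (u := a) (v := c) (w := b) (by grind) (by grind) (by grind)
    (h4 a ha b hb).1 hca.symm hcb ?_
  refine hfA.of_split hfD ?_ ?_
  · intro v
    have := fun h => h4 v h b hb
    have := h4 a ha v
    grind
  · intro v hv hvD
    exact (h4 v (by grind) v (by grind)).1 rfl

/-- A path containing a chosen edge is removed if its ends leave no cut vertex behind. Otherwise the
set is split at that cut vertex. -/
theorem fac_of_tc (hS : TC G S) (hc : ClawFreeOn G S) (h3 : 3 ∣ S.card) (h6 : 6 ≤ S.card) :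
    Fac G S := by
  obtain ⟨x, hx⟩ : S.Nonempty := by rw [← Finset.card_pos]; omega
  obtain ⟨y, hy, hyx⟩ := Finset.exists_mem_ne (by omega : 1 < S.card) x
  obtain ⟨x', hx', y, hy, hyn, hxy⟩ := hS.conn {x} (by grind) (by simp) (by grind)
  obtain rfl : x' = x := by grind
  clear hyx
  have hne := hxy.ne
  have hcx := Finset.card_erase_of_mem hx
  have hcBx : ClawFreeOn G (S.erase x') := hc.mono (by grind)
  by_cases hB : TC G (S.erase x')
  · have hyB : y ∈ S.erase x' := by grind
    have hcy := Finset.card_erase_of_mem hyB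
    by_cases hF : TC G ((S.erase x').erase y)
    · have hne' : ({x', y} : Finset V) ≠ S := by
        intro h
        have := Finset.card_le_two (a := x') (b := y)
        rw [h] at this; omega
      obtain ⟨u, hu, z, hz, hzn, huz⟩ := hS.conn {x', y} (by grind) (by simp) hne'
      have hz' : z ∈ (S.erase x').erase y := by grind
      have hch := hF.chain_erase (hc.mono (by grind)) (by omega) hz'
      have hcz := Finset.card_erase_of_mem hz'
      have hfac : Fac G (((S.erase x').erase y).erase z) := by
        refine ih _ ?_ (by omega) fun _ => hch
        rw [Finset.ssubset_iff_of_subset (by grind)]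
        exact ⟨z, by grind⟩
      rcases (by grind : u = x' ∨ u = y) with rfl | rfl
      · refine Fac.of_sdiff hy hx hz (by grind) hxy.symm huz ?_
        convert hfac using 1; ext; grind
      · refine Fac.of_sdiff hx hy hz (by grind) hxy huz ?_
        convert hfac using 1; ext; grind
    · have hconn := (hB.chain_erase hcBx (by omega) hyB).conn (by omega)
      obtain ⟨c, A, D, hcut⟩ := exists_cut hconn hF
      -- Here |A| + |D| ≡ 0. Up to swapping sides the residues are (0, 0) or (1, 2).
      have main : ∀ A D, Cut G ((S.erase x').erase y) c A D → D.card % 3 ≠ 1 → Fac G S := by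
        intro A D hcut hD
        have hcard := hcut.card
        have pA := hB.piece hyB hcut
        have pD := hB.piece hyB hcut.symm
        have qA := hB.cliqueN' hcBx hyB hcut
        have qA' := hB.cliqueN hcBx hyB hcut
        have qD := hB.cliqueN hcBx hyB hcut.symm
        obtain ⟨h1, h2, h3', h4, h5, h6⟩ := hcut
        have hAD : ∀ v ∈ A, v ∉ D := fun v hv hv' => (h4 v hv v hv').1 rfl
        by_cases hA : 3 ∣ A.card
        · refine Fac.of_card_split ih h3 (A := A) (B := insert x' (insert y (insert c D)))
            h5 (by simp) (by grind) (by grind) hA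
            (fun h => pA.chain (by omega) qA' qA) fun _ => ⟨_, _, pD.ch_leaf h6 hxy ?_ ?_⟩
          · grind
          · grind
        · refine Fac.of_card_split ih h3 (A := insert x' (insert y A)) (B := insert c D)
            (by simp) (by simp) (by grind)
            (by grind) ?_ (fun _ => pA.chain_leaf h5 hxy ?_ ?_ qA)
            (fun _ => pD.symm.chain_insert h6 qD)
          · rw [Finset.card_insert_of_notMem (by grind), Finset.card_insert_of_notMem (by grind)]
            omega
          · grind
          · grind
      have hcard := hcut.card
      by_cases hD : D.card % 3 = 1
      · exact main D A hcut.symm (by omega)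
      · exact main A D hcut hD
  · have hconn := (hS.chain_erase hc (by omega) hx).conn (by omega)
    obtain ⟨c, A, D, hcut⟩ := exists_cut hconn hB
    -- Here |A| + |D| ≡ 1. Up to swapping sides the residues are (0, 1) or (2, 2).
    have main : ∀ A D, Cut G (S.erase x') c A D → D.card % 3 ≠ 0 → Fac G S := by
      intro A D hcut hD
      have hcard := hcut.card
      have pA := hS.piece hx hcut
      have pD := hS.piece hx hcut.symm
      have qA := hS.cliqueN' hc hx hcut
      have qA' := hS.cliqueN hc hx hcut
      have qD := hS.cliqueN' hc hx hcut.symm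
      obtain ⟨h1, h2, h3', h4, h5, h6⟩ := hcut
      have hAD : ∀ v ∈ A, v ∉ D := fun v hv hv' => (h4 v hv v hv').1 rfl
      by_cases hA : 3 ∣ A.card
      · exact Fac.of_card_split ih h3 (A := A) (B := insert x' (insert c D))
          h5 (by simp) (by grind) (by grind) hA
          (fun h => pA.chain (by omega) qA' qA) fun _ => ⟨_, _, pD.ch⟩
      · refine Fac.of_card_split ih h3 (A := insert c A) (B := insert x' D)
          (by simp) (by simp) (by grind) (by grind) ?_
          (fun _ => pA.symm.chain_insert h5 qA') (fun _ => pD.chain_insert h6 qD)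
        rw [Finset.card_insert_of_notMem h2]
        omega
    have hcard := hcut.card
    by_cases hD : D.card % 3 = 0
    · exact main D A hcut.symm (by omega)
    · exact main A D hcut hD

end Induction

/-! ### Chains with two pendant ends -/

/-- Two pendant vertices `p` at `c` and `q` at `d`, all further cut vertices excluded. -/
structure TwoLeaf (G : SimpleGraph V) (S : Finset V) (p c q d : V) : Prop where
  ch : Ch G S p q
  claw : ClawFreeOn G S
  three : 3 ∣ S.card
  six : 6 ≤ S.card
  pc : G.Adj p c
  qd : G.Adj q d
  hc : c ∈ S
  hd : d ∈ S
  hp : ∀ v ∈ S, G.Adj p v → v = c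
  hq : ∀ v ∈ S, G.Adj q v → v = d
  cd : c ≠ d
  cq : c ≠ q
  dp : d ≠ p
  cut : ∀ y C, C ⊆ S → Small G S C y → (∃ u ∈ C, ∃ v ∈ C, u ≠ v) → p ∉ C → c ∉ C →
    y ∈ S → y ∉ C → y ≠ p → y ≠ c → False

namespace TwoLeaf

variable {S : Finset V} {p c q d a f : V} {U : Finset V}

theorem facts (h : TwoLeaf G S p c q d) :
    p ∈ S ∧ q ∈ S ∧ p ≠ q ∧ p ≠ c ∧ q ≠ d ∧ c ≠ q ∧ d ≠ p := by
  obtain ⟨hp, hq, hpq, -⟩ := h.ch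
  have h1 := h.pc.ne
  have h2 := h.qd.ne
  exact ⟨hp, hq, hpq, h1, h2, h.cq, h.dp⟩

theorem clique_c (h : TwoLeaf G S p c q d) : CliqueN G c (S \ {p, c}) := by
  have := h.facts
  refine h.claw.cliqueN (by grind) h.hc this.1 h.pc.symm fun u hu => ⟨by grind, ?_⟩
  have := h.hp u
  grind

/-- A fragment of `S - {p, c, a}` that does not contain `q` and is not adjacent to `c`. -/
structure Side (G : SimpleGraph V) (S : Finset V) (p c q a : V) (U : Finset V) (f : V) : Prop where
  sub : U ⊆ S \ {p, c, a}
  ne : U.Nonempty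
  hq : q ∉ U
  hc : ∀ u ∈ U, ¬ G.Adj c u
  small : Small G (S \ {p, c, a}) U f

/-- By `clique_c`, c touches at most one of two apart parts. The part without q touches c, since
otherwise a would be its only exit. So a alone cuts off the part with q and d, against `cut`. -/
theorem conn_rest (h : TwoLeaf G S p c q d) (ha : a ∈ S) (hane : a ≠ p) (had : a ≠ d)
    (hca : G.Adj c a) : Conn G (S \ {p, c, a}) := by
  have hF := h.facts
  have haq : a ≠ q := by
    rintro rfl
    have := h.hq c h.hc hca.symm
    exact h.cd this
  have hac := hca.ne
  have key : ∀ P Q, P ⊆ S \ {p, c, a} → Q ⊆ S \ {p, c, a} →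
      (∀ v ∈ S \ {p, c, a}, v ∈ P ∨ v ∈ Q) → P.Nonempty → Apart G P Q → q ∈ Q → False := by
    intro P Q hPS hQS hPQ hP hap hqQ
    have hqP : q ∉ P := fun hh => (hap q hh q hqQ).1 rfl
    have hcP : Touch G c P := by
      by_contra hcP
      refine h.ch.2.2.2 P (by grind) hP (by grind) hqP a fun u hu v hv hvP huv => ?_
      have h1 : v ≠ c := by rintro rfl; exact hcP ⟨u, hu, huv.symm⟩
      have h2 : v ≠ p := by
        rintro rfl
        have := h.hp u (by grind) huv.symm
        grind
      have := hap u hu v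
      grind
    have hcQ : ¬ Touch G c Q := fun hcQ =>
      h.clique_c.not_apart (by grind) (by grind) hap hcP hcQ
    have hdQ : d ∈ Q := by
      have := h.cd
      have := h.hd
      have := fun hh => (hap d hh q hqQ).2 h.qd.symm
      grind
    refine h.cut a Q (by grind) ?_ ⟨q, hqQ, d, hdQ, by grind⟩ (by grind) (by grind) ha (by grind)
      hane hac.symm
    intro u hu v hv hvP huv
    have h1 : v ≠ c := by rintro rfl; exact hcQ ⟨u, hu, huv.symm⟩
    have h2 : v ≠ p := by
      rintro rfl
      have := h.hp u (by grind) huv.symm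
      grind
    have := fun hh => (hap v hh u hu).2 huv.symm
    grind
  refine conn_of_apart fun P Q hPS hQS hPQ hP hQ hap => ?_
  rcases hPQ q (by grind) with hv | hv
  · exact key Q P hQS hPS (by grind) hQ hap.symm hv
  · exact key P Q hPS hQS hPQ hP hap hv

/-- If f were q or d, adding q, or q and d, to U would give a set with a as its only exit, against
`cut`. If d ∈ U, the edge qd forces f = q. -/
theorem Side.props (hU : Side G S p c q a U f) (h : TwoLeaf G S p c q d) (ha : a ∈ S)
    (hane : a ≠ p) (had : a ≠ d) (hca : G.Adj c a) :
    f ∈ S \ {p, c, a} ∧ f ≠ q ∧ d ∉ U ∧ f ≠ d ∧ f ∉ U := by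
  have hF := h.facts
  have hcd := h.cd
  have hdS := h.hd
  have hac := hca.ne
  obtain ⟨hsub, hne, hqU, hcU, hsm⟩ := hU
  have haq : a ≠ q := by
    rintro rfl
    exact h.cd (h.hq c h.hc hca.symm)
  have hconn := h.conn_rest ha hane had hca
  have hf : f ∈ S \ {p, c, a} ∧ f ∉ U := by
    obtain ⟨u, hu, v, hv, hvU, huv⟩ := hconn U hsub hne (by grind)
    have := hsm u hu v hv hvU huv
    grind
  have hUp : ∀ u ∈ U, ∀ v ∈ S, v ∉ U → G.Adj u v → v = a ∨ v = f := by
    intro u hu v hv hvU huv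
    have h1 : v ≠ c := by rintro rfl; exact hcU u hu huv.symm
    have h2 : v ≠ p := by
      rintro rfl
      have := h.hp u (by grind) huv.symm
      grind
    have := hsm u hu v
    grind
  have hfq : f ≠ q := by
    rintro rfl
    have hdU : d ∈ U := by
      obtain ⟨u, hu, v, hv, hvU, huv⟩ := hconn U hsub hne (by grind)
      have h1 := hsm u hu v hv hvU huv
      subst h1
      have := h.hq u (by grind) huv.symm
      grind
    refine h.cut a (insert f U) (by grind) ?_ ⟨f, by grind, d, by grind, by grind⟩ (by grind)
      (by grind) ha (by grind) hane hac.symm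
    intro u hu v hv hvU huv
    rcases Finset.mem_insert.1 hu with rfl | hu
    · have := h.hq v hv huv; grind
    · have := hUp u hu v hv; grind
  have hdU : d ∉ U := by
    intro hdU
    have := hsm d hdU q (by grind) hqU h.qd.symm
    exact hfq this.symm
  refine ⟨hf.1, hfq, hdU, ?_, hf.2⟩
  rintro rfl
  obtain ⟨u, hu, v, hv, hvU, huv⟩ := hconn U hsub hne (by grind)
  have h1 := hsm u hu v hv hvU huv
  subst h1
  have hqu : ¬ G.Adj q u := fun hqu => by
    have := h.hq u (by grind) hqu
    grind
  -- Here v is d. Its neighbour q is adjacent to neither u nor w, so u and w are adjacent.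
  have claw : ∀ w ∈ S, G.Adj v w → w ≠ q → w ≠ u → G.Adj u w := by
    intro w hw hvw hwq hwu
    have := h.claw v h.hd q hF.2.1 u (by grind) w hw h.qd.symm huv.symm hvw (by grind) hwq.symm
      hwu.symm
    have := h.hq w hw
    have := hvw.ne
    grind
  refine h.cut a (insert q (insert v U)) (by grind) ?_ ⟨q, by grind, v, by grind, by grind⟩
    (by grind) (by grind) ha (by grind) hane hac.symm
  intro x hx w hw hwU hxw
  simp only [Finset.mem_insert, not_or] at hx hwU
  rcases hx with rfl | rfl | hx
  · have := h.hq w hw hxw; grind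
  · have := claw w hw hxw hwU.1 (by grind)
    have := hUp u hu w hw hwU.2.2 this
    grind
  · have := hUp x hx w hw hwU.2.2 hxw; grind

/-- The last two conclusions are claw-freeness at a and at f, each of which has a neighbour in U. -/
theorem Side.adj (hU : Side G S p c q a U f) (h : TwoLeaf G S p c q d) (ha : a ∈ S)
    (hane : a ≠ p) (had : a ≠ d) (hca : G.Adj c a) :
    (∀ u ∈ U, ∀ v ∈ S, v ∉ U → G.Adj u v → v = a ∨ v = f) ∧ Piece G U a f ∧
    (∀ u ∈ S, u ∉ U → u ≠ f → u ≠ c → G.Adj a u → G.Adj c u) ∧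
    (∀ u ∈ S, u ∉ U → u ≠ a → ∀ v ∈ S, v ∉ U → v ≠ a → u ≠ v → G.Adj f u → G.Adj f v →
      G.Adj u v) := by
  have hF := h.facts
  have hcd := h.cd
  have hdS := h.hd
  have hcS := h.hc
  have hac := hca.ne
  have haq : a ≠ q := by
    rintro rfl
    exact h.cd (h.hq c h.hc hca.symm)
  obtain ⟨hfJ, hfq, hdU, hfd, hfU⟩ := hU.props h ha hane had hca
  obtain ⟨hsub, hne, hqU, hcU, hsm⟩ := hU
  have hUp : ∀ u ∈ U, ∀ v ∈ S, v ∉ U → G.Adj u v → v = a ∨ v = f := by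
    intro u hu v hv hvU huv
    have h1 : v ≠ c := by rintro rfl; exact hcU u hu huv.symm
    have h2 : v ≠ p := by
      rintro rfl
      have := h.hp u (by grind) huv.symm
      grind
    have := hsm u hu v
    grind
  have pcs : Piece G U a f := by
    refine ⟨by grind, hfU, by grind, fun P hP hP0 y hy => ?_⟩
    refine h.ch.2.2.2 P (by grind) hP0 (by grind) (by grind) y fun u hu v hv hvP huv => ?_
    have := hUp u (hP hu) v hv
    exact hy u hu v (by grind) hvP huv
  obtain ⟨ua, hua, haua⟩ := pcs.symm.touch subset_rfl hne (by grind)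
  obtain ⟨uf, huf, hfuf⟩ := pcs.touch subset_rfl hne (by grind)
  have na : ∀ u ∈ S, u ∉ U → u ≠ f → u ≠ c → G.Adj a u → G.Adj c u := by
    intro u hu huU huf huc hau
    have := h.claw a ha c hcS ua (by grind) u hu hca.symm haua hau (by grind) huc.symm (by grind)
    have := hUp ua hua u hu huU
    have := hau.ne
    have := hcU ua hua
    grind
  have nf : ∀ u ∈ S, u ∉ U → u ≠ a → ∀ v ∈ S, v ∉ U → v ≠ a → u ≠ v → G.Adj f u → G.Adj f v →
      G.Adj u v := by
    intro u hu huU hua v hv hvU hva huv hfu hfv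
    have := h.claw f (by grind) uf (by grind) u hu v hv hfuf hfu hfv (by grind) (by grind) huv
    have := hUp uf huf u hu huU
    have := hUp uf huf v hv hvU
    have := hfu.ne
    have := hfv.ne
    grind
  exact ⟨hUp, pcs, na, nf⟩

/-- A single exit of W is p or c. Let C be the rest of Z without p and c. If f ∈ C, the only exit of
C ∪ U is a; if f ∉ Z, the only exit of C is f; both contradict `cut`. Otherwise C has no exit,
against connectivity. -/
theorem Side.not_small_of_touch (hU : Side G S p c q a U f) (h : TwoLeaf G S p c q d) (ha : a ∈ S)
    (hane : a ≠ p) (had : a ≠ d) (hca : G.Adj c a)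
    {Z : Finset V} (hZS : Z ⊆ S) (hZU : ∀ v ∈ Z, v ∉ U)
    (hZ : ∀ v ∈ S, v ∉ U → v ≠ a → v ≠ f → v ∈ Z) (hfa : f ∉ Z → a ∉ Z)
    {W : Finset V} (hWZ : W ⊆ Z) (hpW : p ∉ W) (hqW : q ∉ W)
    (hcW : c ∈ W ∨ Touch G c W) (y : V) : ¬ Small G Z W y := by
  have hF := h.facts
  have hcd := h.cd
  have hdS := h.hd
  have hcS := h.hc
  have hac := hca.ne
  have haq : a ≠ q := by
    rintro rfl
    exact h.cd (h.hq c h.hc hca.symm)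
  obtain ⟨hfJ, hfq, hdU, hfd, hfU⟩ := hU.props h ha hane had hca
  obtain ⟨hUp, pcs, na, nf⟩ := hU.adj h ha hane had hca
  obtain ⟨hsub, hne, hqU, hcU, hsm⟩ := hU
  intro hy
  have hcZ : c ∈ Z := hZ c hcS (by grind) hac (by grind)
  have hpZ : p ∈ Z := hZ p hF.1 (by grind) hane.symm (by grind)
  have hqZ : q ∈ Z := hZ q hF.2.1 hqU haq.symm hfq.symm
  have hdZ : d ∈ Z := hZ d hdS hdU (by grind) hfd.symm
  have hy' : y = p ∨ y = c := by
    rcases hcW with hcW | ⟨u, hu, hcu⟩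
    · exact .inl (hy c hcW p hpZ hpW h.pc.symm).symm
    · by_cases hcW : c ∈ W
      · exact .inl (hy c hcW p hpZ hpW h.pc.symm).symm
      · exact .inr (hy u hu c hcZ hcW hcu.symm).symm
  have hcl := h.clique_c
  let C := Z \ insert p (insert c W)
  have hC : ∀ v, v ∈ C ↔ v ∈ Z ∧ v ≠ p ∧ v ≠ c ∧ v ∉ W := by
    intro v; simp only [C, Finset.mem_sdiff, Finset.mem_insert, not_or]
  clear_value C
  have hWC : ∀ u ∈ W, ∀ v ∈ C, ¬ G.Adj u v := by
    intro u hu v hv huv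
    have := hy u hu v
    grind
  have hcC : ∀ v ∈ C, ¬ G.Adj c v := by
    intro v hv hcv
    by_cases hcW' : c ∈ W
    · exact hWC c hcW' v hv hcv
    · obtain ⟨u, hu, hcu⟩ := hcW.resolve_left hcW'
      exact hWC u hu v hv (hcl u (by grind) v (by grind) (by grind) hcu hcv)
  have hpC : ∀ v ∈ C, ¬ G.Adj p v := by
    intro v hv hpv
    have := h.hp v
    grind
  have haC : ∀ v ∈ C, G.Adj a v → v = f := by
    intro v hv hav
    by_contra hvf
    have := na v (by grind) (by grind) hvf (by grind) hav
    exact hcC v hv this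
  have haC' : a ∉ C := fun haC' => hcC a haC' hca
  have hqC : q ∈ C := by grind
  have hUC : ∀ v ∈ C, v ≠ f → ∀ u ∈ U, ¬ G.Adj v u := by
    intro v hv hvf u hu hvu
    have := hUp u hu v (by grind) (by grind) hvu.symm
    grind
  have hdC : f ∉ Z → d ∈ C := by
    intro hfZ
    have hdW : d ∉ W := fun hdW => hWC d hdW q hqC h.qd.symm
    grind
  have hout : ∀ u ∈ C, ∀ v ∈ S, v ∉ C → G.Adj u v → u = f ∨ v = f := by
    intro u hu v hv hvC huv
    by_contra hcon
    push Not at hcon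
    have h1 := hUC u hu hcon.1 v
    have h2 := haC u hu
    have h3 := huv.symm
    have h4 := fun hh => hWC v hh u hu
    have h5 := hcC u hu
    have h6 := hpC u hu
    grind
  by_cases hfC : f ∈ C
  · obtain ⟨u0, hu0⟩ := hne
    refine h.cut a (C ∪ U) (by grind) ?_ ⟨q, by grind, u0, by grind, by grind⟩ (by grind)
      (by grind) ha (by grind) hane hac.symm
    intro u hu v hv hvC huv
    have hvC1 : v ∉ C := by grind
    have hvU : v ∉ U := by grind
    by_cases huU : u ∈ U
    · have := hUp u huU v hv hvU huv; grind
    · have huC : u ∈ C := by grind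
      have h3 := huv.symm
      have h4 := fun hh => hWC v hh u huC
      have h5 := hcC u huC
      have h6 := hpC u huC
      grind
  · by_cases hfZ : f ∈ Z
    · have hconn := h.ch.conn (by have := h.six; omega)
      obtain ⟨u, hu, v, hv, hvC, huv⟩ := hconn C (by grind) ⟨q, hqC⟩ (by grind)
      have h1 := hout u hu v hv hvC huv
      have h2 : v = f := by grind
      subst h2
      have h3 := huv.symm
      have h4 := fun hh => hWC v hh u hu
      have h5 := hcC u hu
      have h6 := hpC u hu
      grind
    · refine h.cut f C (by grind) ?_ ⟨q, hqC, d, hdC hfZ, by grind⟩ (by grind) (by grind)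
        (by grind) hfC (by grind) (by grind)
      intro u hu v hv hvC huv
      have := hout u hu v hv hvC huv
      grind

/-- Deleting a maximal side leaves a chain. -/
theorem Side.ch_rest (hU : Side G S p c q a U f) (h : TwoLeaf G S p c q d) (ha : a ∈ S)
    (hane : a ≠ p) (had : a ≠ d) (hca : G.Adj c a)
    (hmax : ∀ U' f', Side G S p c q a U' f' → ¬ U ⊂ U')
    {Z : Finset V} (hZS : Z ⊆ S) (hZU : ∀ v ∈ Z, v ∉ U)
    (hZ : ∀ v ∈ S, v ∉ U → v ≠ a → v ≠ f → v ∈ Z) (hfa : f ∉ Z → a ∉ Z) : Ch G Z p q := by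
  have hF := h.facts
  have hcd := h.cd
  have hdS := h.hd
  have hcS := h.hc
  have hac := hca.ne
  have haq : a ≠ q := by
    rintro rfl
    exact h.cd (h.hq c h.hc hca.symm)
  obtain ⟨hfJ, hfq, hdU, hfd, hfU⟩ := hU.props h ha hane had hca
  obtain ⟨hUp, pcs, na, nf⟩ := hU.adj h ha hane had hca
  obtain ⟨hsub, hne, hqU, hcU, hsm⟩ := id hU
  refine ⟨hZ p hF.1 (by grind) hane.symm (by grind), hZ q hF.2.1 hqU haq.symm hfq.symm, hF.2.2.1, ?_⟩
  intro W hWZ hW0 hpW hqW y hy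
  have hcZ : c ∈ Z := hZ c hcS (by grind) hac (by grind)
  have hpZ : p ∈ Z := hZ p hF.1 (by grind) hane.symm (by grind)
  have hqZ : q ∈ Z := hZ q hF.2.1 hqU haq.symm hfq.symm
  have hdZ : d ∈ Z := hZ d hdS hdU (by grind) hfd.symm
  by_cases hcW : c ∈ W ∨ Touch G c W
  · exact hU.not_small_of_touch h ha hane had hca hZS hZU hZ hfa hWZ hpW hqW hcW y hy
  -- Now W either enlarges U to a bigger side, against maximality, or has a single exit in all of S,
  -- against `ch`.
  · push Not at hcW
    obtain ⟨hcW, hcT⟩ := hcW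
    have hcT' : ∀ u ∈ W, ¬ G.Adj c u := fun u hu hcu => hcT ⟨u, hu, hcu⟩
    have haW : a ∉ W := fun haW => hcT' a haW hca
    have hWS : ∀ u ∈ W, u ∈ S \ {p, c, a} ∧ u ∉ U := by
      intro u hu
      have := hWZ hu
      have := hZU u this
      have := hZS (hWZ hu)
      simp only [Finset.mem_sdiff, Finset.mem_insert, Finset.mem_singleton]
      grind
    have haW' : ∀ u ∈ W, G.Adj a u → u = f := by
      intro u hu hau
      by_contra huf
      exact hcT' u hu (na u (by grind) (by grind) huf (by grind) hau)
    by_cases hfW : f ∈ W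
    · refine hmax (U ∪ W) y ⟨Finset.union_subset hsub fun u hu => (hWS u hu).1,
        hne.mono Finset.subset_union_left, by grind, by grind, ?_⟩ ?_
      · intro u hu v hv hvU huv
        by_cases huU : u ∈ U
        · have := hUp u huU v
          grind
        · exact hy u (by grind) v (hZ v (by grind) (by grind) (by grind) (by grind)) (by grind) huv
      · rw [Finset.ssubset_iff_of_subset (by grind)]
        exact ⟨f, by grind⟩
    · by_cases hfZ : ∃ u ∈ W, G.Adj f u ∧ f ∉ Z
      -- The deleted vertex f joins the larger side. Its outside neighbours other than a are
      -- adjacent to u0, so y stays the only exit.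
      · obtain ⟨u0, hu0, hfu0, hfZ⟩ := hfZ
        refine hmax (insert f (U ∪ W)) y ⟨by grind, ⟨f, by grind⟩, by grind, ?_, ?_⟩ ?_
        · intro u hu hcu
          rcases (by grind : u = f ∨ u ∈ U ∨ u ∈ W) with rfl | hu | hu
          · exact hcT' u0 hu0 (nf c hcS (by grind) hac u0 (by grind) (by grind) (by grind)
              (by grind) hcu.symm hfu0)
          · exact hcU u hu hcu
          · exact hcT' u hu hcu
        · intro u hu v hv hvU huv
          simp only [Finset.mem_insert, Finset.mem_union, not_or] at hu hvU
          have hvZ := hZ v (by grind) hvU.2.1 (by grind) hvU.1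
          rcases hu with rfl | hu | hu
          · refine hy u0 hu0 v hvZ hvU.2.2 ?_
            refine nf u0 (by grind) (by grind) (by grind) v (by grind) (by grind) (by grind)
              (by grind) hfu0 huv
          · have := hUp u hu v; grind
          · exact hy u hu v hvZ hvU.2.2 huv
        · rw [Finset.ssubset_iff_of_subset (by grind)]
          exact ⟨f, by grind⟩
      · push Not at hfZ
        refine h.ch.2.2.2 W (by grind) hW0 hpW hqW y fun u hu v hv hvW huv => ?_
        by_cases hvZ : v ∈ Z
        · exact hy u hu v hvZ hvW huv
        · exfalso
          have hua : u ≠ a := by rintro rfl; exact haW hu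
          have huf : u ≠ f := by rintro rfl; exact hfW hu
          have hvU : v ∉ U := fun hvU =>
            (hUp v hvU u (hZS (hWZ hu)) (hWS u hu).2 huv.symm).elim hua huf
          have hva : v ≠ a := by rintro rfl; exact huf (haW' u hu huv.symm)
          have hvf : v ≠ f := by rintro rfl; exact hvZ (hfZ u hu huv.symm)
          exact hvZ (hZ v hv hvU hva hvf)

end TwoLeaf

/-! ### Pendant ends and the main induction -/

section Induction

variable {S : Finset V} (ih : ∀ T ⊂ S, 3 ∣ T.card → (T.Nonempty → Chain G T) → Fac G T)
include ih

theorem fac_of_chain_sdiff (h3 : 3 ∣ S.card) {p c a : V} (hp : p ∈ S) (hc : c ∈ S) (ha : a ∈ S)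
    (hpa : p ≠ a) (hpc : G.Adj p c) (hca : G.Adj c a) (h : Chain G (S \ {p, c, a})) :
    Fac G S := by
  have := hpc.ne
  have := hca.ne
  refine Fac.of_sdiff hp hc ha hpa hpc hca (ih _ ?_ ?_ fun _ => h)
  · rw [Finset.ssubset_iff_of_subset (by grind)]
    exact ⟨p, by grind⟩
  · rw [Finset.card_sdiff_of_subset (by grind),
      Finset.card_eq_three.2 ⟨p, c, a, by grind, by grind, by grind, rfl⟩]
    omega

/-- If removing the path p c a leaves no chain, some fragment misses both q and the neighbours of c.
For a maximal such U, one of U, U ∪ {a}, U ∪ {a, f} has order divisible by 3; it is a chain, and by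
maximality so is its complement. -/
theorem TwoLeaf.fac {p c q d : V} (h : TwoLeaf G S p c q d) : Fac G S := by
  classical
  have hF := h.facts
  have hcd := h.cd
  have hdS := h.hd
  have hcS := h.hc
  have h6 := h.six
  have h3 := h.three
  by_cases hex : ∃ a ∈ S, a ≠ p ∧ a ≠ d ∧ G.Adj c a
  swap
  · push Not at hex
    -- The only possible neighbours of c are p and d, so d cuts off the pair p, c.
    have hcut : Cut G S d {p, c} (S \ {p, c, d}) := by
      refine ⟨by grind, by grind, by grind, ?_, by simp, ?_⟩
      · intro u hu v hv
        have := hex v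
        have := h.hp v
        grind
      · exact ⟨q, by grind⟩
    exact fac_of_cut_two_mod ih ⟨_, _, h.ch⟩ h.claw h3 hcut (by rw [Finset.card_pair hF.2.2.2.1])
  obtain ⟨a, ha, hane, had, hca⟩ := hex
  have hac := hca.ne
  have haq : a ≠ q := by
    rintro rfl
    exact hcd (h.hq c hcS hca.symm)
  by_cases hJ : Chain G (S \ {p, c, a})
  · exact fac_of_chain_sdiff ih h3 hF.1 hcS ha hane.symm h.pc hca hJ
  have hex : ∃ U, ∃ f, TwoLeaf.Side G S p c q a U f := by
    by_contra hcon
    push Not at hcon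
    refine hJ (chain_of_two_types (τ₁ := fun P => q ∈ P) (τ₂ := fun P => Touch G c P)
      (h.conn_rest ha hane had hca) ?_ ?_ ?_ ?_)
    · rw [Finset.card_sdiff_of_subset (by grind),
        Finset.card_eq_three.2 ⟨p, c, a, by grind, by grind, by grind, rfl⟩]
      omega
    · rintro P ⟨hPS, hP0, y, hy, -⟩
      by_contra hc2
      push Not at hc2
      exact hcon P y ⟨hPS, hP0, hc2.1, fun u hu hcu => hc2.2 ⟨u, hu, hcu⟩, hy⟩
    · intro P Q _ _ hap hP hQ
      exact (hap q hP q hQ).1 rfl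
    · intro P Q hPS hQS hap hP hQ
      exact h.clique_c.not_apart (by grind) (by grind) hap hP hQ
  obtain ⟨U, f, hU, hmax⟩ : ∃ U f, TwoLeaf.Side G S p c q a U f ∧
      ∀ U' f', TwoLeaf.Side G S p c q a U' f' → ¬ U ⊂ U' := by
    obtain ⟨U₀, f₀, h₀⟩ := hex
    obtain ⟨U, hU⟩ := (S.powerset.filter
      fun U => ∃ f, TwoLeaf.Side G S p c q a U f).exists_maximal ⟨U₀, by
        rw [Finset.mem_filter, Finset.mem_powerset]
        exact ⟨h₀.sub.trans Finset.sdiff_subset, f₀, h₀⟩⟩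
    obtain ⟨hU1, hU2⟩ := hU
    rw [Finset.mem_filter] at hU1
    obtain ⟨-, f, hf⟩ := hU1
    refine ⟨U, f, hf, fun U' f' h' hlt => hlt.2 (hU2 ?_ hlt.1)⟩
    exact Finset.mem_filter.2
      ⟨Finset.mem_powerset.2 (h'.sub.trans Finset.sdiff_subset), f', h'⟩
  obtain ⟨hfJ, hfq, hdU, hfd, hfU⟩ := hU.props h ha hane had hca
  obtain ⟨hUp, pcs, na, nf⟩ := hU.adj h ha hane had hca
  have rest := fun Z => hU.ch_rest h ha hane had hca hmax (Z := Z)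
  have hne := hU.ne
  have hsub := hU.sub
  have hqU := hU.hq
  have qa : CliqueN G a U := by
    refine h.claw.cliqueN (by grind) ha hcS hca.symm fun u hu => ⟨?_, hU.hc u hu⟩
    have := hsub hu
    grind
  have qf : CliqueN G f U := by
    obtain ⟨g, hg, hgU, hga, hfg⟩ : ∃ g ∈ S, g ∉ U ∧ g ≠ a ∧ G.Adj f g := by
      by_contra hcon
      push Not at hcon
      refine h.ch.2.2.2 (insert f U) (by grind) (by simp) (by grind) (by grind) a ?_
      intro u hu v hv hvU huv
      rcases Finset.mem_insert.1 hu with rfl | hu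
      · by_contra hva
        exact hcon v hv (by grind) hva huv
      · have := hUp u hu v hv; grind
    refine h.claw.cliqueN (by grind) (by grind) hg hfg fun u hu => ⟨by grind, fun hgu => ?_⟩
    have := hUp u hu g hg hgU hgu.symm
    have := hfg.ne
    grind
  have hUS : U ⊆ S := hsub.trans Finset.sdiff_subset
  have haU : a ∉ U := fun h => by have := hsub h; grind
  have hpU : p ∉ U := fun h => by have := hsub h; grind
  rcases (by omega : 3 ∣ U.card ∨ U.card % 3 = 2 ∨ U.card % 3 = 1) with hm | hm | hm
  · refine Fac.of_card_split ih h3 (A := U) (B := S \ U) hne ⟨p, by grind⟩ (by grind) (by grind) hm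
      (fun _ => pcs.chain (by omega) qa qf) fun _ => ⟨p, q, rest _ (by grind) ?_ ?_ ?_⟩
    all_goals grind
  · refine Fac.of_card_split ih h3 (A := insert a U) (B := S \ insert a U) (by simp)
      ⟨p, by grind⟩ (by grind) (by grind) ?_
      (fun _ => pcs.chain_insert hne qf) fun _ => ⟨p, q, rest _ (by grind) ?_ ?_ ?_⟩
    · rw [Finset.card_insert_of_notMem haU]; omega
    all_goals grind
  · refine Fac.of_card_split ih h3 (A := insert a (insert f U)) (B := S \ insert a (insert f U))
      (by simp) ⟨p, by grind⟩ (by grind) (by grind) ?_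
      (fun _ => ⟨_, _, pcs.ch⟩) fun _ => ⟨p, q, rest _ (by grind) ?_ ?_ ?_⟩
    · rw [Finset.card_insert_of_notMem (by grind), Finset.card_insert_of_notMem hfU]; omega
    all_goals grind

/-- If S without p, c is 2-connected, a path p c a can be removed. Otherwise it has a cut vertex d
with a side missing the neighbours of c. In S too d cuts that side off, so it is the single vertex
t, a second pendant end. -/
theorem fac_of_leaf {p t c : V} (hS : Ch G S p t) (hc : ClawFreeOn G S) (h3 : 3 ∣ S.card)
    (h6 : 6 ≤ S.card) (hcS : c ∈ S) (hpc : G.Adj p c) (hp : ∀ v ∈ S, G.Adj p v → v = c)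
    (hcut : ∀ y A D, Cut G S y A D → A.card = 1 ∨ D.card = 1) : Fac G S := by
  obtain ⟨hpS, htS, hpt, -⟩ := id hS
  have hpc' := hpc.ne
  have hconn := hS.conn (by omega)
  have hcutc : Cut G S c {p} (S \ {p, c}) := by
    refine ⟨by grind, by grind, by grind, ?_, by simp, ?_⟩
    · intro u hu v hv
      have := hp v
      grind
    · rw [← Finset.card_pos, Finset.card_sdiff_of_subset (by grind), Finset.card_pair hpc']; omega
  have hRcard : (S \ {p, c}).card = S.card - 2 := by
    rw [Finset.card_sdiff_of_subset (by grind), Finset.card_pair hpc']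
  by_cases hR : TC G (S \ {p, c})
  · obtain ⟨a, ha, hca⟩ := hcutc.symm.touch hconn
    have := hR.chain_erase (hc.mono Finset.sdiff_subset) (by omega) ha
    have he : (S \ {p, c}).erase a = S \ {p, c, a} := by ext; grind
    rw [he] at this
    exact fac_of_chain_sdiff ih h3 hpS hcS (by grind) (by grind) hpc hca this
  have hRc := hcutc.symm.chain_side ⟨p, t, hS⟩ hc (by omega)
  obtain ⟨d, A, D, hcutd⟩ := exists_cut (hRc.conn (by omega)) hR
  obtain ⟨A, D, hcutd, hcD⟩ : ∃ A D, Cut G (S \ {p, c}) d A D ∧ ¬ Touch G c D := by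
    by_cases hD : Touch G c D
    · refine ⟨D, A, hcutd.symm, fun hA => ?_⟩
      have hq := hcutc.symm.cliqueN hconn hc
      obtain ⟨h1, h2, h3, h4, -, -⟩ := hcutd
      exact hq.not_apart (by grind) (by grind) h4 hA hD
    · exact ⟨A, D, hcutd, hD⟩
  have hcd : Cut G S d D (S \ insert d D) := by
    obtain ⟨h1, h2, h3, h4, h5, h6⟩ := hcutd
    refine ⟨?_, h3, by grind, ?_, h6, ⟨p, by grind⟩⟩
    · intro v; have := h1 v; grind
    · intro u hu v hv
      refine ⟨by grind, fun huv => ?_⟩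
      have h7 := h4.symm u hu v
      have h8 : v ≠ c := by rintro rfl; exact hcD ⟨u, hu, huv.symm⟩
      have h9 : v ≠ p := by
        rintro rfl
        have := hp u (by grind) huv.symm
        grind
      grind
  have hpD : p ∉ D := by have := hcutd.1; grind
  have hcD' : c ∉ D := by have := hcutd.1; grind
  have hdS : d ∈ S \ {p, c} := by have := hcutd.1; grind
  have hDcard : D.card = 1 := by
    rcases hcut _ _ _ hcd with h | h
    · exact h
    · have : ({p, c} : Finset V) ⊆ S \ insert d D := by grind
      have := Finset.card_le_card this
      rw [Finset.card_pair hpc'] at this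
      omega
  have htD : t ∈ D := by
    have := hcd.ends hS
    grind
  obtain ⟨q, rfl⟩ := Finset.card_eq_one.1 hDcard
  obtain rfl : t = q := by simpa using htD
  have htd : G.Adj t d := by
    obtain ⟨u, hu, h⟩ := hcd.touch hconn
    obtain rfl : u = t := by simpa using hu
    exact h.symm
  refine TwoLeaf.fac ih (p := p) (c := c) (q := t) (d := d) ⟨hS, hc, h3, h6, hpc, htd, hcS, by grind,
    hp, ?_, by grind, by grind, by grind, ?_⟩
  · intro v hv htv
    have := hcd.2.2.2.1 t (by simp) v
    have := htv.ne
    grind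
  · rintro y C hCS hy ⟨u, hu, v, hv, huv⟩ hpC hcC hyS hyC hyp hyc
    have hcutC : Cut G S y C (S \ insert y C) := by
      refine ⟨by grind, hyC, by grind, ?_, ⟨u, hu⟩, ⟨p, by grind⟩⟩
      intro x hx w hw
      have := hy x hx w
      grind
    have h1 : ({p, c} : Finset V) ⊆ S \ insert y C := by grind
    have h2 : ({u, v} : Finset V) ⊆ C := by grind
    have h1 := Finset.card_le_card h1
    have h2 := Finset.card_le_card h2
    rw [Finset.card_pair hpc'] at h1
    rw [Finset.card_pair huv] at h2
    have := hcut _ _ _ hcutC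
    omega

end Induction

/-- A connected claw-free graph with at most two end-blocks whose order is divisible by 3
has a partition into 3-vertex paths. -/
theorem fac_of_chain (S : Finset V) (hS : S.Nonempty → Chain G S) (hc : ClawFreeOn G S)
    (h3 : 3 ∣ S.card) : Fac G S := by
  induction S using Finset.strongInduction with
  | H S ih' =>
    have ih : ∀ T ⊂ S, 3 ∣ T.card → (T.Nonempty → Chain G T) → Fac G T :=
      fun T hT h3 h => ih' T hT h (hc.mono hT.1) h3
    rcases S.eq_empty_or_nonempty with rfl | h0
    · exact .empty
    have hS := hS h0
    by_cases hc3 : S.card = 3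
    · exact fac_of_card_three hS hc3
    have h6 : 6 ≤ S.card := by have := h0.card_pos; omega
    by_cases htc : TC G S
    · exact fac_of_tc ih htc hc h3 h6
    have hconn := hS.conn (by omega)
    -- The residues of the two sides sum to 2: one of them is 2, or both are 1.
    by_cases hmod : ∃ c A D, Cut G S c A D ∧ A.card % 3 ≠ 1
    · obtain ⟨c, A, D, hcut, hA⟩ := hmod
      have hcard := hcut.card
      by_cases hA2 : A.card % 3 = 2
      · exact fac_of_cut_two_mod ih hS hc h3 hcut hA2
      · exact fac_of_cut_two_mod ih hS hc h3 hcut.symm (by omega)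
    push Not at hmod
    by_cases hbig : ∃ c A D, Cut G S c A D ∧ 1 < A.card ∧ 1 < D.card
    · obtain ⟨c, A, D, hcut, hA, hD⟩ := hbig
      exact fac_of_cut_of_one_lt ih hS hcut (hmod _ _ _ hcut) (hmod _ _ _ hcut.symm) hA hD
    push Not at hbig
    have hone : ∀ y A D, Cut G S y A D → A.card = 1 ∨ D.card = 1 := by
      intro y A D h
      have := hbig y A D h
      have := h.2.2.2.2.1.card_pos
      have := h.2.2.2.2.2.card_pos
      omega
    obtain ⟨c, A, D, hcut⟩ := exists_cut hconn htc
    have main : ∀ A D, Cut G S c A D → A.card = 1 → Fac G S := by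
      intro A D hcut hA
      obtain ⟨p, rfl⟩ := Finset.card_eq_one.1 hA
      obtain ⟨t, ht⟩ : ∃ t, Ch G S p t := by
        obtain ⟨s, t, h⟩ := hS
        rcases hcut.ends h with h' | h'
        · obtain rfl : s = p := by simpa using h'.1
          exact ⟨t, h⟩
        · obtain rfl : t = p := by simpa using h'.1
          exact ⟨s, h.symm⟩
      obtain ⟨u, hu, hcp⟩ := hcut.touch hconn
      obtain rfl : u = p := by simpa using hu
      refine fac_of_leaf ih ht hc h3 h6 (c := c) ((hcut.1 c).2 (.inl rfl)) hcp.symm ?_ hone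
      intro v hv huv
      have := hcut.2.2.2.1 u (by simp) v
      have := hcut.1 v
      have := huv.ne
      grind
    rcases hone _ _ _ hcut with h | h
    · exact main A D hcut h
    · exact main D A hcut.symm h

/-! ### Avoiding a given edge -/

theorem Cut.frag {S A D : Finset V} {c : V} (h : Cut G S c A D) : Frag G S A := by
  obtain ⟨h1, h2, h3, h4, h5, z, hz⟩ := h
  refine ⟨by grind, h5, c, ?_, z, by grind, fun hzA => (h4 z hzA z hz).1 rfl, by grind⟩
  intro u hu v hv hvA huv
  have := h4 u hu v
  grind

theorem TC.ch {S : Finset V} (h : TC G S) {s t : V} (hs : s ∈ S) (ht : t ∈ S) (hst : s ≠ t) :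
    Ch G S s t := by
  refine ⟨hs, ht, hst, fun P hPS hP hsP htP y hy => h P ⟨hPS, hP, y, hy, ?_⟩⟩
  by_cases hsy : s = y
  · exact ⟨t, ht, htP, by grind⟩
  · exact ⟨s, hs, hsP, hsy⟩

theorem adj_deleteEdges {a b u v : V} (h : G.Adj u v) (h1 : ¬ (u = a ∧ v = b))
    (h2 : ¬ (u = b ∧ v = a)) : (G.deleteEdges {s(a, b)}).Adj u v := by
  rw [SimpleGraph.deleteEdges_adj]
  refine ⟨h, ?_⟩
  rw [Set.mem_singleton_iff, Sym2.eq_iff]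
  tauto

theorem Fac.deleteEdges {S : Finset V} (h : Fac G S) {a b : V} (hab : ¬ (a ∈ S ∧ b ∈ S)) :
    Fac (G.deleteEdges {s(a, b)}) S := by
  induction h with
  | empty => exact .empty
  | step S u v w hu hv hw huw huv hvw hS ih =>
    exact .step S u v w hu hv hw huw (adj_deleteEdges huv (by grind) (by grind))
      (adj_deleteEdges hvw (by grind) (by grind)) (ih (by grind))

theorem fac_delete_of_chain {S : Finset V} {a b : V} (hc : ClawFreeOn G S) (h3 : 3 ∣ S.card)
    (hS : 3 ≤ S.card → Chain G S) (hab : ¬ (a ∈ S ∧ b ∈ S)) :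
    Fac (G.deleteEdges {s(a, b)}) S :=
  (fac_of_chain S (fun h0 => hS (three_dvd_nonempty h3 h0)) hc h3).deleteEdges hab

theorem fac_delete_of_path {S T : Finset V} {a b w : V} (hab : a ≠ b)
    (haw : G.Adj a w) (hbw : G.Adj b w) (hT : Fac (G.deleteEdges {s(a, b)}) T)
    (ha : a ∉ T) (hb : b ∉ T) (hw : w ∉ T) (hS : ∀ v, v ∈ S ↔ v = a ∨ v = b ∨ v = w ∨ v ∈ T) :
    Fac (G.deleteEdges {s(a, b)}) S := by
  have h1 := haw.ne
  have h2 := hbw.ne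
  refine Fac.of_sdiff (u := a) (v := w) (w := b) (by grind) (by grind) (by grind) hab
    (adj_deleteEdges haw (by grind) (by grind)) (adj_deleteEdges hbw.symm (by grind) (by grind)) ?_
  convert hT using 1
  ext v
  by_cases v = a <;> by_cases v = b <;> by_cases v = w <;> grind

theorem fac_delete_of_split {S A B : Finset V} {a b : V} (hc : ClawFreeOn G S) (h3 : 3 ∣ S.card)
    (hAB : ∀ v, v ∈ S ↔ v ∈ A ∨ v ∈ B) (hd : ∀ v ∈ A, v ∉ B) (hA3 : 3 ∣ A.card)
    (hA : 3 ≤ A.card → Chain G A) (hB : 3 ≤ B.card → Chain G B) (hab : ¬ (a ∈ A ∧ b ∈ A))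
    (hab' : ¬ (a ∈ B ∧ b ∈ B)) : Fac (G.deleteEdges {s(a, b)}) S := by
  have hcard : S.card = A.card + B.card := by
    rw [← Finset.card_union_of_disjoint (Finset.disjoint_left.2 hd)]
    congr 1; ext; grind
  exact (fac_delete_of_chain (hc.mono (by grind)) hA3 hA hab).of_split
    (fac_delete_of_chain (hc.mono (by grind)) (by omega) hB hab') hAB hd

/-- Sets avoiding a and b do not see the edge ab, so the chain survives. A new claw would have a and
b as leaves and a common neighbour as centre. -/
theorem fac_delete_of_no_common {S : Finset V} {a b : V} (hc : ClawFreeOn G S) (h3 : 3 ∣ S.card)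
    (hS : Ch G S a b) (hw : ∀ w ∈ S, G.Adj a w → ¬ G.Adj b w) :
    Fac (G.deleteEdges {s(a, b)}) S := by
  obtain ⟨ha, hb, hab, h⟩ := hS
  refine fac_of_chain S (fun _ => ⟨a, b, ha, hb, hab, fun P hPS hP haP hbP y hy => ?_⟩) ?_ h3
  · refine h P hPS hP haP hbP y fun u hu v hv hvP huv => hy u hu v hv hvP ?_
    exact adj_deleteEdges huv (by grind) (by grind)
  · intro c hcS x hx y hy z hz hcx hcy hcz hxy hxz hyz
    have hle := SimpleGraph.deleteEdges_le (G := G) {s(a, b)}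
    have key : ∀ x y, G.Adj c x → G.Adj c y → G.Adj x y → (G.deleteEdges {s(a, b)}).Adj x y := by
      intro x y hx hy hxy
      refine adj_deleteEdges hxy (fun h => ?_) (fun h => ?_)
      · exact hw c hcS (h.1 ▸ hx.symm) (h.2 ▸ hy.symm)
      · exact hw c hcS (h.2 ▸ hy.symm) (h.1 ▸ hx.symm)
    rcases hc c hcS x hx y hy z hz (hle hcx) (hle hcy) (hle hcz) hxy hxz hyz with h | h | h
    · exact .inl (key x y (hle hcx) (hle hcy) h)
    · exact .inr (.inl (key x z (hle hcx) (hle hcz) h))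
    · exact .inr (.inr (key y z (hle hcy) (hle hcz) h))

/-- The case of a vertex `a` attached to a 2-connected graph. -/
theorem fac_delete_of_tc_insert {M : Finset V} {a b w : V} (hM : TC G M) (hb : b ∈ M) (ha : a ∉ M)
    (hc : ClawFreeOn G (insert a M)) (hab : G.Adj a b) (hmod : M.card % 3 = 2)
    (hw : w ∈ M) (haw : G.Adj a w) (hbw : G.Adj b w) :
    Fac (G.deleteEdges {s(a, b)}) (insert a M) := by
  have hcM : ClawFreeOn G M := hc.mono (by grind)
  have hne := hab.ne
  have hbw' := hbw.ne
  have hcard := Finset.card_erase_of_mem hb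
  have hwF : w ∈ M.erase b := by grind
  by_cases hF : (M.erase b).card = 1 ∨ TC G (M.erase b)
  · have hcw := Finset.card_erase_of_mem hwF
    refine fac_delete_of_path (T := (M.erase b).erase w) hne haw hbw
      (fac_delete_of_chain (hcM.mono (by grind)) (by omega) (fun h => ?_) (by grind))
      (by grind) (by grind) (by grind) (by grind)
    exact (hF.resolve_left (by omega)).chain_erase (hcM.mono (by grind)) (by omega) hwF
  push Not at hF
  obtain ⟨hF1, hF⟩ := hF
  have hFpos := Finset.card_pos.2 ⟨w, hwF⟩
  have hcF : ClawFreeOn G (M.erase b) := hcM.mono (by grind)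
  have hconn := (hM.chain_erase hcM (by omega) hb).conn (by omega)
  -- The vertex b has neighbours in minimal fragments on both sides of the cut. With a as third
  -- neighbour, claw-freeness at b makes a adjacent to one of them.
  obtain ⟨P, hPf, hPm, u, hu, hau, hbu⟩ : ∃ P, Frag G (M.erase b) P ∧
      (∀ R ⊂ P, ¬ Frag G (M.erase b) R) ∧ ∃ u ∈ P, G.Adj a u ∧ G.Adj b u := by
    obtain ⟨c, A, D, hcut⟩ := exists_cut hconn hF
    obtain ⟨P₁, hP₁, hf₁, hm₁⟩ := exists_min_frag hcut.frag
    obtain ⟨P₂, hP₂, hf₂, hm₂⟩ := exists_min_frag hcut.symm.frag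
    obtain ⟨v₁, hv₁, hb₁⟩ := hM.touch_of_frag hf₁
    obtain ⟨v₂, hv₂, hb₂⟩ := hM.touch_of_frag hf₂
    have hap := hcut.2.2.2.1 v₁ (hP₁ hv₁) v₂ (hP₂ hv₂)
    have h1 := hf₁.1 hv₁
    have h2 := hf₂.1 hv₂
    rcases hc b (by grind) a (by grind) v₁ (by grind) v₂ (by grind) hab.symm hb₁ hb₂ (by grind)
      (by grind) hap.1 with h | h | h
    · exact ⟨P₁, hf₁, hm₁, v₁, hv₁, h, hb₁⟩
    · exact ⟨P₂, hf₂, hm₂, v₂, hv₂, h, hb₂⟩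
    · exact absurd h hap.2
  obtain ⟨g, Q, hcut⟩ := hPf.cut hconn
  have hcard2 := hcut.card
  have pQ := hM.piece hb hcut.symm
  have qP := hcut.cliqueN hconn hcF
  have qQ := hcut.symm.cliqueN hconn hcF
  have qbQ := hM.cliqueN hcM hb hcut.symm
  obtain ⟨x, hx, hgx⟩ := hcut.touch hconn
  obtain ⟨h1, h2, h3, h4, h5, z, hz⟩ := id hcut
  have hPQ : ∀ v ∈ P, v ∉ Q := fun v hv hvQ => (h4 v hv v hvQ).1 rfl
  have hMe : ∀ v, v ∈ M ↔ v = b ∨ v = g ∨ v ∈ P ∨ v ∈ Q := by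
    intro v
    have := h1 v
    by_cases v = b <;> grind
  have hbF : ∀ v, v = g ∨ v ∈ P ∨ v ∈ Q → v ≠ b ∧ v ≠ a := by grind
  have small : ∀ P' ⊂ P, P'.Nonempty → ∀ y, Small G (insert g P) P' y → False := by
    intro P' hP' hP'0 y hy
    refine hPm P' hP' ⟨hP'.1.trans hPf.1, hP'0, y, ?_, ?_⟩
    · intro u hu v hv hvP huv
      have := h4 u (hP'.1 hu) v
      exact hy u hu v (by grind) hvP huv
    · have := hP'.1
      by_cases hgy : g = y
      · exact ⟨z, by grind⟩
      · exact ⟨g, by grind⟩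
  have pP : Piece G P a g := by
    refine ⟨by grind, h2, by grind, fun P' hP' hP'0 y hy => ?_⟩
    by_cases hPP : P' = P
    · subst hPP
      have := hy u hu a (by grind) (by grind) hau.symm
      have := hy x hx g (by grind) h2 hgx.symm
      grind
    · refine small P' (Finset.ssubset_iff_subset_ne.2 ⟨hP', hPP⟩) hP'0 y ?_
      exact fun u hu v hv => hy u hu v (by grind)
  have hcardI : (insert a M).card = M.card + 1 := Finset.card_insert_of_notMem ha
  -- Here |P| + |Q| ≡ 0. The first two cases separate a from b. In the third P ∪ {g} is 2-connected,
  -- so it can spare u for the path a u b.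
  rcases (by omega : P.card % 3 = 1 ∨ P.card % 3 = 2 ∨ 3 ∣ P.card) with hm | hm | hm
  · refine fac_delete_of_split (A := insert a (insert g P)) (B := insert b Q) hc (by omega)
      (by grind) (by grind) ?_ (fun _ => ⟨_, _, pP.ch⟩) (fun _ => pQ.chain_insert ⟨z, hz⟩ qQ)
      (by grind) (by grind)
    rw [Finset.card_insert_of_notMem (by grind), Finset.card_insert_of_notMem h2]
    omega
  · refine fac_delete_of_split (A := insert a P) (B := insert b (insert g Q)) hc (by omega)
      (by grind) (by grind) ?_ (fun _ => pP.chain_insert h5 qP) (fun _ => ⟨_, _, pQ.ch⟩)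
      (by grind) (by grind)
    rw [Finset.card_insert_of_notMem (by grind)]
    omega
  · have htc : TC G (insert g P) := by
      rintro P' ⟨hP', hP'0, y, hy, z', hz'⟩
      by_cases hg : g ∈ P'
      · refine small (P \ insert y P') ?_ ⟨z', by grind⟩ y ?_
        · rw [Finset.ssubset_iff_of_subset (by grind)]
          have := hy g hg x (by grind)
          exact ⟨x, by grind⟩
        · intro u hu v hv hvP huv
          have := huv.symm
          have := fun hh => hy v hh u
          grind
      · refine small P' (Finset.ssubset_iff_subset_ne.2 ⟨by grind, ?_⟩) hP'0 y hy
        rintro rfl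
        have := hy x hx g (by grind) h2 hgx.symm
        grind
    have huI : u ∈ insert g P := by grind
    have hcu := Finset.card_erase_of_mem huI
    have hcg : (insert g P).card = P.card + 1 := Finset.card_insert_of_notMem h2
    have hf1 : Fac (G.deleteEdges {s(a, b)}) ((insert g P).erase u) :=
      fac_delete_of_chain (hc.mono (by grind)) (by omega)
        (fun _ => htc.chain_erase (hc.mono (by grind)) (by omega) huI) (by grind)
    have hf2 : Fac (G.deleteEdges {s(a, b)}) Q :=
      fac_delete_of_chain (hc.mono (by grind)) (by omega)
        (fun _ => pQ.chain (by omega) qbQ qQ) (by grind)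
    refine fac_delete_of_path (w := u) hne hau hbu
      (hf1.of_split (S := (insert g P).erase u ∪ Q) hf2 (by grind) (by grind))
      (by grind) (by grind) (by grind) (by grind)

theorem exists_apart_of_not_conn {S : Finset V} (h : ¬ Conn G S) :
    ∃ P Q, P ⊆ S ∧ Q ⊆ S ∧ (∀ v ∈ S, v ∈ P ∨ v ∈ Q) ∧ P.Nonempty ∧ Q.Nonempty ∧ Apart G P Q := by
  by_contra hcon
  exact h (conn_of_apart fun P Q h1 h2 h3 h4 h5 h6 => hcon ⟨P, Q, h1, h2, h3, h4, h5, h6⟩)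

/-- For a common neighbour w, either C - w is connected and the path a w b can be removed, or C - w
falls into two parts, one touched only by a and the other only by b. -/
theorem fac_delete_of_piece {C : Finset V} {a b : V} (hp : Piece G C a b)
    (hc : ClawFreeOn G (insert a (insert b C))) (hmod : C.card % 3 = 1)
    (qa : CliqueN G a C) (qb : CliqueN G b C) :
    Fac (G.deleteEdges {s(a, b)}) (insert a (insert b C)) := by
  obtain ⟨ha, hb, hne, hp4⟩ := id hp
  have hcard : (insert a (insert b C)).card = C.card + 2 := by
    rw [Finset.card_insert_of_notMem (by grind), Finset.card_insert_of_notMem hb]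
  by_cases hw : ∀ w ∈ insert a (insert b C), G.Adj a w → ¬ G.Adj b w
  · exact fac_delete_of_no_common hc (by omega) hp.ch hw
  push Not at hw
  obtain ⟨w, hw, haw, hbw⟩ := hw
  have haw' := haw.ne
  have hbw' := hbw.ne
  have hwC : w ∈ C := by grind
  have hcC : ClawFreeOn G C := hc.mono (by grind)
  have hcw := Finset.card_erase_of_mem hwC
  by_cases hT : Conn G (C.erase w)
  · refine fac_delete_of_path (T := C.erase w) hne haw hbw (fac_delete_of_chain
      (hcC.mono (by grind)) (by omega) (fun h => chain_of_frags hT (by omega) ?_) (by grind))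
      (by grind) (by grind) (by grind) (by grind)
    -- By the clique conditions w is adjacent to all other neighbours of a and b in C, so a fragment
    -- away from w is away from a and b.
    have touch : ∀ P, Frag G (C.erase w) P → Touch G w P := by
      rintro P ⟨hPT, hP0, y, hy, -⟩
      by_contra ht
      have ht' : ∀ u ∈ P, ¬ G.Adj w u := fun u hu hwu => ht ⟨u, hu, hwu⟩
      refine hp4 P (by grind) hP0 y fun u hu v hv hvP huv => ?_
      have huT := hPT hu
      have h1 : v ≠ a := by
        rintro rfl
        exact ht' u hu (qa w hwC u (by grind) (by grind) haw huv.symm)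
      have h2 : v ≠ b := by
        rintro rfl
        exact ht' u hu (qb w hwC u (by grind) (by grind) hbw huv.symm)
      have h3 : v ≠ w := by
        rintro rfl
        exact ht' u hu huv.symm
      exact hy u hu v (by grind) hvP huv
    intro P₁ P₂ P₃ f₁ f₂ f₃ a₁₂ a₁₃ a₂₃
    obtain ⟨u₁, hu₁, h₁⟩ := touch _ f₁
    obtain ⟨u₂, hu₂, h₂⟩ := touch _ f₂
    obtain ⟨u₃, hu₃, h₃⟩ := touch _ f₃
    have m₁ := f₁.1 hu₁
    have m₂ := f₂.1 hu₂
    have m₃ := f₃.1 hu₃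
    have q₁ := a₁₂ u₁ hu₁ u₂ hu₂
    have q₂ := a₁₃ u₁ hu₁ u₃ hu₃
    have q₃ := a₂₃ u₂ hu₂ u₃ hu₃
    have := hcC w hwC u₁ (by grind) u₂ (by grind) u₃ (by grind) h₁ h₂ h₃ q₁.1 q₂.1 q₃.1
    tauto
  obtain ⟨P, Q, hPT, hQT, hPQ, hP, hQ, hap⟩ := exists_apart_of_not_conn hT
  have touch : ∀ P Q, P ⊆ C.erase w → P.Nonempty → (∀ v ∈ C.erase w, v ∈ P ∨ v ∈ Q) →
      Apart G P Q → Touch G a P ∨ Touch G b P := by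
    intro P Q hPT hP hPQ hap
    by_contra ht
    push Not at ht
    refine hp4 P (by grind) hP w fun u hu v hv hvP huv => ?_
    have h1 : v ≠ a := by rintro rfl; exact ht.1 ⟨u, hu, huv.symm⟩
    have h2 : v ≠ b := by rintro rfl; exact ht.2 ⟨u, hu, huv.symm⟩
    have := hap u hu v
    grind
  have main : ∀ P Q, P ⊆ C.erase w → Q ⊆ C.erase w → (∀ v ∈ C.erase w, v ∈ P ∨ v ∈ Q) →
      P.Nonempty → Q.Nonempty → Apart G P Q → ¬ Touch G b P → ¬ Touch G a Q →
      Fac (G.deleteEdges {s(a, b)}) (insert a (insert b C)) := by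
    intro P Q hPT hQT hPQ hP hQ hap hbP haQ
    have hd : ∀ v ∈ P, v ∉ Q := fun v hv hvQ => (hap v hv v hvQ).1 rfl
    have hCe : ∀ v, v ∈ C ↔ v = w ∨ v ∈ P ∨ v ∈ Q := by grind
    have hcPQ : (C.erase w).card = P.card + Q.card := by
      rw [← Finset.card_union_of_disjoint (Finset.disjoint_left.2 hd)]
      congr 1; ext; grind
    have hbP' : ∀ u ∈ P, ¬ G.Adj u b := fun u hu h => hbP ⟨u, hu, h.symm⟩
    have haQ' : ∀ u ∈ Q, ¬ G.Adj u a := fun u hu h => haQ ⟨u, hu, h.symm⟩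
    have pP : Piece G P a w := by
      refine ⟨by grind, by grind, by grind, fun P' hP' hP0 y hy => ?_⟩
      refine hp4 P' (by grind) hP0 y fun u hu v hv hvP huv => ?_
      have := hap u (hP' hu) v
      have := hbP' u (hP' hu)
      exact hy u hu v (by grind) hvP huv
    have pQ : Piece G Q b w := by
      refine ⟨by grind, by grind, by grind, fun P' hP' hP0 y hy => ?_⟩
      refine hp4 P' (by grind) hP0 y fun u hu v hv hvP huv => ?_
      have := hap.symm u (hP' hu) v
      have := haQ' u (hP' hu)
      exact hy u hu v (by grind) hvP huv
    obtain ⟨x, hx, hwx⟩ := pP.touch subset_rfl hP (by grind)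
    obtain ⟨z, hz, hwz⟩ := pQ.touch subset_rfl hQ (by grind)
    have qP : CliqueN G w P := hcC.cliqueN (by grind) hwC (by grind) hwz (hap.symm z hz)
    have qQ : CliqueN G w Q := hcC.cliqueN (by grind) hwC (by grind) hwx (hap x hx)
    have qaP : CliqueN G a P := fun u hu v hv => qa u (by grind) v (by grind)
    have qbQ : CliqueN G b Q := fun u hu v hv => qb u (by grind) v (by grind)
    have haP : a ∉ P := by grind
    have hwP : w ∉ P := by grind
    have hIe : ∀ v, v ∈ insert a (insert b C) ↔ v = a ∨ v = b ∨ v = w ∨ v ∈ P ∨ v ∈ Q := by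
      intro v; rw [Finset.mem_insert, Finset.mem_insert, hCe]
    have hall : ∀ v, v = w ∨ v ∈ P ∨ v ∈ Q → v ≠ a ∧ v ≠ b := by grind
    have hwQ : w ∉ Q := by grind
    clear hPQ touch hp4 hPT hQT
    rcases (by omega : P.card % 3 = 1 ∨ P.card % 3 = 2 ∨ 3 ∣ P.card) with hm | hm | hm
    · refine fac_delete_of_split (A := insert a (insert w P)) (B := insert b Q) hc (by omega)
        (by grind) (by grind) ?_ (fun _ => ⟨_, _, pP.ch⟩) (fun _ => pQ.chain_insert hQ qQ)
        (by grind) (by grind)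
      rw [Finset.card_insert_of_notMem (by grind), Finset.card_insert_of_notMem hwP]
      omega
    · refine fac_delete_of_split (A := insert a P) (B := insert b (insert w Q)) hc (by omega)
        (by grind) (by grind) ?_ (fun _ => pP.chain_insert hP qP) (fun _ => ⟨_, _, pQ.ch⟩)
        (by grind) (by grind)
      rw [Finset.card_insert_of_notMem haP]
      omega
    · have hf1 : Fac (G.deleteEdges {s(a, b)}) P :=
        fac_delete_of_chain (hc.mono (by grind)) hm (fun _ => pP.chain (by omega) qaP qP)
          (by grind)
      have hf2 : Fac (G.deleteEdges {s(a, b)}) Q :=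
        fac_delete_of_chain (hc.mono (by grind)) (by omega)
          (fun _ => pQ.chain (by omega) qbQ qQ) (by grind)
      exact fac_delete_of_path (w := w) hne haw hbw
        (hf1.of_split (S := P ∪ Q) hf2 (by grind) (by grind))
        (by grind) (by grind) (by grind) (by grind)
  have hna := fun h1 h2 => qa.not_apart (P := P) (Q := Q) (by grind) (by grind) hap h1 h2
  have hnb := fun h1 h2 => qb.not_apart (P := P) (Q := Q) (by grind) (by grind) hap h1 h2
  have t1 := touch P Q hPT hP hPQ hap
  have t2 := touch Q P hQT hQ (by grind) hap.symm
  by_cases haP : Touch G a P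
  · exact main P Q hPT hQT hPQ hP hQ hap (by tauto) (by tauto)
  · exact main Q P hQT hPT (by grind) hQ hP hap.symm (by tauto) (by tauto)

/-- The residues of the two sides sum to 1. For (2, 2), a and b go to different sides; otherwise the
side of order ≡ 0 stands alone and the other is a piece between a and b. -/
theorem fac_delete_of_not_conn {S : Finset V} {a b : V} (hS : TC G S) (hc : ClawFreeOn G S)
    (h3 : 3 ∣ S.card) (ha : a ∈ S) (hb : b ∈ S) (hne : a ≠ b) (hF : ¬ Conn G (S \ {a, b})) :
    Fac (G.deleteEdges {s(a, b)}) S := by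
  obtain ⟨P, Q, hPF, hQF, hPQ, hP, hQ, hap⟩ := exists_apart_of_not_conn hF
  have hcF : (S \ {a, b}).card = S.card - 2 := by
    rw [Finset.card_sdiff_of_subset (by grind), Finset.card_pair hne]
  have hSe : ∀ v, v ∈ S ↔ v = a ∨ v = b ∨ v ∈ P ∨ v ∈ Q := by grind
  have hd : ∀ v ∈ P, v ∉ Q := fun v hv hvQ => (hap v hv v hvQ).1 rfl
  have hcPQ : (S \ {a, b}).card = P.card + Q.card := by
    rw [← Finset.card_union_of_disjoint (Finset.disjoint_left.2 hd)]
    congr 1; ext; grind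
  have hS2 : 2 ≤ S.card := by
    rw [← Finset.card_pair hne]; exact Finset.card_le_card (by grind)
  have piece : ∀ P Q, P ⊆ S \ {a, b} → (∀ v ∈ S \ {a, b}, v ∈ P ∨ v ∈ Q) → Apart G P Q →
      Piece G P a b := by
    intro P Q hPF hPQ hap
    refine ⟨by grind, by grind, hne, fun P' hP' hP0 y hy => hS P' ⟨by grind, hP0, y, ?_, ?_⟩⟩
    · intro u hu v hv hvP huv
      have := hap u (hP' hu) v
      exact hy u hu v (by grind) hvP huv
    · by_cases hay : a = y
      · exact ⟨b, by grind⟩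
      · exact ⟨a, by grind⟩
  have pP := piece P Q hPF hPQ hap
  have pQ := piece Q P hQF (by grind) hap.symm
  have clique : ∀ P Q, P ⊆ S \ {a, b} → Q ⊆ S \ {a, b} → Q.Nonempty → Apart G P Q →
      ∀ a ∈ S, Touch G a Q → CliqueN G a P := by
    intro P Q hPF hQF hQ hap a ha ⟨z, hz, haz⟩
    exact hc.cliqueN (by grind) ha (by grind) haz (hap.symm z hz)
  have tP := pP.touch subset_rfl hP (by grind)
  have tQ := pQ.touch subset_rfl hQ (by grind)
  have tP' := pP.symm.touch subset_rfl hP (by grind)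
  have tQ' := pQ.symm.touch subset_rfl hQ (by grind)
  have qaP := clique P Q hPF hQF hQ hap a ha tQ'
  have qbP := clique P Q hPF hQF hQ hap b hb tQ
  have qaQ := clique Q P hQF hPF hP hap.symm a ha tP'
  have qbQ := clique Q P hQF hPF hP hap.symm b hb tP
  obtain ⟨naP, nbP, -, -⟩ := id pP
  obtain ⟨naQ, nbQ, -, -⟩ := id pQ
  rcases (by omega : P.card % 3 = 2 ∨ 3 ∣ P.card ∨ 3 ∣ Q.card) with hm | hm | hm
  · refine fac_delete_of_split (A := insert a P) (B := insert b Q) hc h3 (by grind) (by grind) ?_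
      (fun _ => pP.chain_insert hP qbP) (fun _ => pQ.symm.chain_insert hQ qaQ) (by grind) (by grind)
    rw [Finset.card_insert_of_notMem naP]; omega
  · refine (fac_delete_of_chain (hc.mono (by grind)) hm (fun _ => pP.chain (by omega) qaP qbP)
      (by grind)).of_split (fac_delete_of_piece pQ (hc.mono (by grind)) (by omega) qaQ qbQ)
      (by grind) (by grind)
  · refine (fac_delete_of_chain (hc.mono (by grind)) hm (fun _ => pQ.chain (by omega) qaQ qbQ)
      (by grind)).of_split (fac_delete_of_piece pP (hc.mono (by grind)) (by omega) qaP qbP)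
      (by grind) (by grind)

/-- The cut of S - a is chosen with the side M containing b smallest. In the one residue case where
a and b cannot be separated, this makes M ∪ {c} 2-connected, and a is attached to it. -/
theorem fac_delete_of_not_tc {S : Finset V} {a b w : V} (hS : TC G S) (hc : ClawFreeOn G S)
    (h3 : 3 ∣ S.card) (h6 : 6 ≤ S.card) (ha : a ∈ S) (hb : b ∈ S) (hab : G.Adj a b)
    (hw : w ∈ S) (haw : G.Adj a w) (hbw : G.Adj b w) (hF : Conn G (S \ {a, b}))
    (hT : ¬ TC G (S.erase a)) : Fac (G.deleteEdges {s(a, b)}) S := by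
  classical
  have hne := hab.ne
  have hca := Finset.card_erase_of_mem ha
  have hconn := (hS.chain_erase hc (by omega) ha).conn (by omega)
  have hcb : ∀ c A D, Cut G (S.erase a) c A D → b ≠ c := by
    rintro c A D ⟨h1, h2, h3, h4, h5, z, hz⟩ rfl
    obtain ⟨u, hu, v, hv, hvA, huv⟩ := hF A (by grind) h5 (by
      have := fun u hu => h4 u hu z hz
      grind)
    have := h4 u hu v
    grind
  have hex : ∃ n, ∃ c X M, Cut G (S.erase a) c X M ∧ b ∈ M ∧ M.card = n := by
    obtain ⟨c, A, D, hcut⟩ := exists_cut hconn hT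
    have := hcb c A D hcut
    have := hcut.1 b
    by_cases hbD : b ∈ D
    · exact ⟨_, c, A, D, hcut, hbD, rfl⟩
    · exact ⟨_, c, D, A, hcut.symm, by grind, rfl⟩
  obtain ⟨c, X, M, hcut, hbM, hMn⟩ := Nat.find_spec hex
  have hmin : ∀ c' X' M', Cut G (S.erase a) c' X' M' → b ∈ M' → M.card ≤ M'.card := by
    intro c' X' M' h hb'
    rw [hMn]
    exact Nat.find_min' hex ⟨c', X', M', h, hb', rfl⟩
  have hcard := hcut.card
  have pX := hS.piece ha hcut
  have pM := hS.piece ha hcut.symm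
  have qaX := hS.cliqueN hc ha hcut
  have qcX := hS.cliqueN' hc ha hcut
  have qaM := hS.cliqueN hc ha hcut.symm
  have qcM := hS.cliqueN' hc ha hcut.symm
  obtain ⟨x, hx, hax⟩ := hS.touch ha hcut
  obtain ⟨m, hm, hcm⟩ := hcut.symm.touch hconn
  have hbc := hcb c X M hcut
  obtain ⟨h1, h2, h3', h4, h5, h6'⟩ := id hcut
  have hSe : ∀ v, v ∈ S ↔ v = a ∨ v = c ∨ v ∈ X ∨ v ∈ M := by
    intro v
    have := h1 v
    by_cases v = a <;> grind
  have hd : ∀ v ∈ X, v ∉ M := fun v hv hvM => (h4 v hv v hvM).1 rfl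
  have hall : ∀ v, v = c ∨ v ∈ X ∨ v ∈ M → v ≠ a := by grind
  clear hMn hex
  rcases (by omega : X.card % 3 = 2 ∨ X.card % 3 = 1 ∨ 3 ∣ X.card) with hmod | hmod | hmod
  · refine fac_delete_of_split (A := insert a X) (B := insert c M) hc h3 (by grind) (by grind) ?_
      (fun _ => pX.chain_insert h5 qcX) (fun _ => pM.symm.chain_insert h6' qaM)
      (by grind) (by grind)
    rw [Finset.card_insert_of_notMem (by grind)]; omega
  · refine fac_delete_of_split (A := insert a (insert c X)) (B := M) hc h3 (by grind) (by grind) ?_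
      (fun _ => ⟨_, _, pX.ch⟩) (fun h => pM.chain (by omega) qaM qcM)
      (by grind) (by grind)
    rw [Finset.card_insert_of_notMem (by grind), Finset.card_insert_of_notMem h2]; omega
  · have hcM : (insert c M).card = M.card + 1 := Finset.card_insert_of_notMem h3'
    -- Such a P has a neighbour of a. If b ∈ P, it gives a smaller M; if b is its exit, deleting a
    -- and b disconnects S; otherwise a has a claw with leaves b, x, t.
    have main : ∀ P ⊂ M, P.Nonempty → ∀ y, Small G (insert c M) P y → False := by
      intro P hPM hP0 y hy
      have hsub := hPM.1
      have hsm : Small G (S.erase a) P y := by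
        intro u hu v hv hvP huv
        have := h4.symm u (hsub hu) v
        exact hy u hu v (by grind) hvP huv
      obtain ⟨t, ht, hat⟩ : Touch G a P := by
        by_contra ht
        refine hS P ⟨by grind, hP0, y, ?_, ?_⟩
        · intro u hu v hv hvP huv
          have h5 : v ≠ a := by rintro rfl; exact ht ⟨u, hu, huv.symm⟩
          exact hsm u hu v (by grind) hvP huv
        · by_cases hay : a = y
          · exact ⟨c, by grind⟩
          · exact ⟨a, by grind⟩
      by_cases hbP : b ∈ P
      · have hfr : Frag G (S.erase a) P := by
          refine ⟨by grind, hP0, y, hsm, ?_⟩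
          by_cases hcy : c = y
          · exact ⟨x, by grind⟩
          · exact ⟨c, by grind⟩
        obtain ⟨c', D', hcut'⟩ := hfr.cut hconn
        have := hmin c' D' P hcut'.symm hbP
        have := Finset.card_lt_card hPM
        omega
      · by_cases hby : b = y
        · obtain ⟨u, hu, v, hv, hvP, huv⟩ := hF P (by grind) hP0 (by
            have := hd x hx
            have : x ∈ S \ {a, b} := by grind
            grind)
          have := hsm u hu v (by grind) hvP huv
          grind
        · have hbt : ¬ G.Adj b t := fun h => hby (hsm t ht b (by grind) hbP h.symm)
          have hxb := h4 x hx b hbM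
          have hxt := h4 x hx t (hsub ht)
          have := hc a ha b hb x (by grind) t (by grind) hab hax hat hxb.1.symm (by grind) hxt.1
          have := fun h : G.Adj b x => hxb.2 h.symm
          tauto
    have htc : TC G (insert c M) := by
      rintro P ⟨hP, hP0, y, hy, z, hz⟩
      by_cases hcP : c ∈ P
      · refine main (M \ insert y P) ?_ ⟨z, by grind⟩ y ?_
        · rw [Finset.ssubset_iff_of_subset (by grind)]
          have := hy c hcP m (by grind)
          exact ⟨m, by grind⟩
        · intro u hu v hv hvP huv
          have := huv.symm
          have := fun hh => hy v hh u
          grind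
      · refine main P (Finset.ssubset_iff_subset_ne.2 ⟨by grind, ?_⟩) hP0 y hy
        rintro rfl
        have := hy m hm c (by grind) h3' hcm.symm
        grind
    have hwM : w ∈ insert c M := by
      have := hbw.ne
      have := haw.ne
      have := fun h => (h4 w h b hbM).2 hbw.symm
      grind
    refine (fac_delete_of_chain (hc.mono (by grind)) hmod (fun _ => pX.chain (by omega) qaX qcX)
      (by grind)).of_split (fac_delete_of_tc_insert htc (by grind) (by grind) (hc.mono (by grind))
        hab (by omega) hwM haw hbw) (by grind) (by grind)

/-- In a 2-connected claw-free graph whose order is divisible by 3, some partition into 3-vertex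
paths avoids a given edge. -/
theorem fac_delete_of_tc {S : Finset V} {a b : V} (hS : TC G S) (hc : ClawFreeOn G S)
    (h3 : 3 ∣ S.card) (ha : a ∈ S) (hb : b ∈ S) (hab : G.Adj a b) :
    Fac (G.deleteEdges {s(a, b)}) S := by
  have hne := hab.ne
  by_cases hw : ∀ w ∈ S, G.Adj a w → ¬ G.Adj b w
  · exact fac_delete_of_no_common hc h3 (hS.ch ha hb hne) hw
  push Not at hw
  obtain ⟨w, hw, haw, hbw⟩ := hw
  by_cases hc3 : S.card = 3
  · have hsub : {a, b, w} ⊆ S := by grind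
    have := haw.ne
    have := hbw.ne
    have hSe := Finset.eq_of_subset_of_card_le hsub (by
      rw [hc3, Finset.card_eq_three.2 ⟨a, b, w, by grind, by grind, by grind, rfl⟩])
    exact fac_delete_of_path (T := ∅) hne haw hbw .empty (by simp) (by simp) (by simp)
      (by rw [← hSe]; simp)
  have h6 : 6 ≤ S.card := by have := Finset.card_pos.2 ⟨a, ha⟩; omega
  by_cases hF : Conn G (S \ {a, b})
  · by_cases hT : TC G (S.erase a)
    · have hca := Finset.card_erase_of_mem ha
      have hIe := Finset.insert_erase ha
      have hwa := haw.ne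
      have := fac_delete_of_tc_insert hT (a := a) (b := b) (w := w) (by grind) (by grind)
        (by rwa [hIe]) hab (by omega) (by grind) haw hbw
      rwa [hIe] at this
    · exact fac_delete_of_not_tc hS hc h3 h6 ha hb hab hw haw hbw hF hT
  · exact fac_delete_of_not_conn hS hc h3 ha hb hne hF

end Decidable

/-! ### Translation to graph factors and connectivity -/

theorem nonempty_iso_pathGraph_three {P : SimpleGraph V} {a b c v : V} (hac : a ≠ c)
    (hab : P.Adj a b) (hbc : P.Adj b c) (ha : ∀ w, P.Adj a w → w = b)
    (hb : ∀ w, P.Adj b w → w = a ∨ w = c) (hc : ∀ w, P.Adj c w → w = b)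
    (hv : v = a ∨ v = b ∨ v = c) :
    Nonempty ((P.connectedComponentMk v).toSimpleGraph ≃g SimpleGraph.pathGraph 3) := by
  have hvb : P.Reachable v b := by
    rcases hv with rfl | rfl | rfl
    · exact hab.reachable
    · exact .rfl
    · exact hbc.symm.reachable
  have hreach : ∀ w, P.Reachable v w ↔ w = a ∨ w = b ∨ w = c := by
    refine fun w => ⟨?_, ?_⟩
    · rintro ⟨p⟩
      clear hvb
      induction p with
      | nil => exact hv
      | cons h p ih =>
        refine ih ?_
        rcases hv with rfl | rfl | rfl
        · exact .inr (.inl (ha _ h))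
        · have := hb _ h; tauto
        · exact .inr (.inl (hc _ h))
    · rintro (rfl | rfl | rfl)
      · exact hvb.trans hab.symm.reachable
      · exact hvb
      · exact hvb.trans hbc.reachable
  have hmem : ∀ w, w ∈ P.connectedComponentMk v ↔ w = a ∨ w = b ∨ w = c := by
    intro w
    rw [← hreach, SimpleGraph.reachable_comm]
    exact SimpleGraph.ConnectedComponent.eq
  have h1 := hab.ne
  have h2 := hbc.ne
  have ha' := (hmem a).2 (by simp)
  have hb' := (hmem b).2 (by simp)
  have hc' := (hmem c).2 (by simp)
  let f : Fin 3 → P.connectedComponentMk v := ![⟨a, ha'⟩, ⟨b, hb'⟩, ⟨c, hc'⟩]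
  have hf : f.Bijective := by
    constructor
    · intro i j h
      have h := congrArg Subtype.val h
      fin_cases i <;> fin_cases j <;> simp_all [f]
    · rintro ⟨w, hw⟩
      rcases (hmem w).1 hw with rfl | rfl | rfl
      exacts [⟨0, rfl⟩, ⟨1, rfl⟩, ⟨2, rfl⟩]
  have e : SimpleGraph.pathGraph 3 ≃g (P.connectedComponentMk v).toSimpleGraph := by
    refine ⟨Equiv.ofBijective f hf, ?_⟩
    intro i j
    have hac' : ¬ P.Adj a c := fun h => h2 (ha c h).symm
    have hca' : ¬ P.Adj c a := fun h => hac' h.symm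
    change P.Adj (f i) (f j) ↔ _
    fin_cases i <;> fin_cases j <;>
      simp [f, SimpleGraph.pathGraph_adj, hab, hbc, hab.symm, hbc.symm, hac', hca']
  exact ⟨e.symm⟩

theorem Fac.exists_graph [DecidableEq V] {S : Finset V} (h : Fac G S) :
    ∃ P ≤ G, (∀ u v, P.Adj u v → u ∈ S ∧ v ∈ S) ∧ ∀ v ∈ S, ∃ a ∈ S, ∃ b ∈ S, ∃ c ∈ S, a ≠ c ∧
      P.Adj a b ∧ P.Adj b c ∧ (∀ w, P.Adj a w → w = b) ∧ (∀ w, P.Adj b w → w = a ∨ w = c) ∧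
      (∀ w, P.Adj c w → w = b) ∧ (v = a ∨ v = b ∨ v = c) := by
  induction h with
  | empty => exact ⟨⊥, bot_le, by simp, by simp⟩
  | step S u v w hu hv hw huw huv hvw hS ih =>
    obtain ⟨P, hPG, hPS, hP⟩ := ih
    have h1 := huv.ne
    have h2 := hvw.ne
    have hadj : ∀ s t, (P ⊔ SimpleGraph.edge u v ⊔ SimpleGraph.edge v w).Adj s t ↔ P.Adj s t ∨
        (s = u ∧ t = v) ∨ (s = v ∧ t = u) ∨ (s = v ∧ t = w) ∨ (s = w ∧ t = v) := by
      intro s t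
      simp only [SimpleGraph.sup_adj, SimpleGraph.edge_adj]
      grind
    refine ⟨P ⊔ SimpleGraph.edge u v ⊔ SimpleGraph.edge v w, ?_, ?_, ?_⟩
    · intro s t h
      rcases (hadj s t).1 h with h | ⟨rfl, rfl⟩ | ⟨rfl, rfl⟩ | ⟨rfl, rfl⟩ | ⟨rfl, rfl⟩
      exacts [hPG h, huv, huv.symm, hvw, hvw.symm]
    · intro s t h
      have := hPS s t
      have := (hadj s t).1 h
      grind
    · intro z hz
      by_cases hzS : z ∈ S
      · obtain ⟨a, ha, b, hb, c, hc, hac, hab, hbc, h⟩ := hP z hzS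
        refine ⟨a, by grind, b, by grind, c, by grind, hac, ?_⟩
        simp only [hadj]
        grind
      · refine ⟨u, by grind, v, by grind, w, by grind, huw, ?_⟩
        have := hPS u
        have := hPS v
        have := hPS w
        simp only [hadj]
        grind

theorem clawFreeOn_of_isClawFree (h : G.IsClawFree) (S : Finset V) : ClawFreeOn G S := by
  intro c _ a _ b _ d _ hca hcb hcd hab had hbd
  by_contra hcon
  push Not at hcon
  obtain ⟨h1, h2, h3⟩ := hcon
  have h1' : ¬ G.Adj b a := fun h => h1 h.symm
  have h2' : ¬ G.Adj d a := fun h => h2 h.symm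
  have h3' : ¬ G.Adj d b := fun h => h3 h.symm
  have n1 := hca.ne
  have n2 := hcb.ne
  have n3 := hcd.ne
  refine h ⟨⟨⟨Sum.elim (fun _ => c) ![a, b, d], ?_⟩, ?_⟩⟩
  · rintro (i | i) (j | j) hij
    · fin_cases i; fin_cases j; rfl
    · fin_cases j <;> simp_all
    · fin_cases i <;> simp_all
    · fin_cases i <;> fin_cases j <;> simp_all
  · intro s t
    change G.Adj (Sum.elim (fun _ : Fin 1 => c) ![a, b, d] s)
      (Sum.elim (fun _ : Fin 1 => c) ![a, b, d] t) ↔ _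
    rcases s with i | i <;> rcases t with j | j
    · simp
    · fin_cases j <;> simp [hca, hcb, hcd]
    · fin_cases i <;> simp [hca.symm, hcb.symm, hcd.symm]
    · fin_cases i <;> fin_cases j <;> simp [h1, h2, h3, h1', h2', h3']

theorem tc_of_isKConnected [Fintype V] [DecidableEq V] (h : G.IsKConnected 3) (x : V) :
    TC G (Finset.univ.erase x) := by
  rintro P ⟨hPS, ⟨u, hu⟩, y, hy, z, hz, hzP, hzy⟩
  have hsep : ∀ S : Finset V, S.card < 3 → u ∉ S → z ∉ S → ∃ v ∈ P, ∃ w ∉ S, w ∉ P ∧ G.Adj v w := by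
    intro S hS huS hzS
    obtain ⟨p⟩ := (h.2 S hS).preconnected ⟨u, huS⟩ ⟨z, hzS⟩
    obtain ⟨d, -, hd1, hd2⟩ := p.exists_boundary_dart {w | w.1 ∈ P} hu hzP
    exact ⟨d.fst, hd1, d.snd, d.snd.2, hd2, d.adj⟩
  have hux := hPS hu
  -- If y ∈ P, no edge of G - x leaves P, so x alone separates; otherwise x and y together do.
  by_cases hyP : y ∈ P
  · obtain ⟨v, hv, w, hw, hwP, hvw⟩ := hsep {x} (by simp) (by grind) (by grind)
    have := hy v hv w (by grind) hwP hvw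
    grind
  · obtain ⟨v, hv, w, hw, hwP, hvw⟩ := hsep {x, y} (Finset.card_le_two.trans_lt (by norm_num))
      (by grind) (by grind)
    have := hy v hv w (by grind) hwP hvw
    grind

end LambdaFactor

theorem mainTheorem8 {V : Type*} [Fintype V] (G : SimpleGraph V)
    (hconn : G.IsKConnected 3) (hclaw : G.IsClawFree)
    (hcard : Fintype.card V ≡ 1 [MOD 3])
    (x : V) (e : Sym2 V) (he : e ∈ G.edgeSet) :
    (G.deleteVertexEdge x e).HasLambdaFactor := by
  classical
  induction e using Sym2.ind with
  | h a b =>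
    have hab : G.Adj a b := he
    have hS := LambdaFactor.tc_of_isKConnected hconn x
    have hc := LambdaFactor.clawFreeOn_of_isClawFree hclaw (Finset.univ.erase x)
    have hScard : (Finset.univ.erase x).card = Fintype.card V - 1 := by
      rw [Finset.card_erase_of_mem (Finset.mem_univ x), Finset.card_univ]
    have h3 : 3 ∣ (Finset.univ.erase x).card := by
      rw [hScard]
      exact (Nat.modEq_iff_dvd' (by have := hconn.1; omega)).1 hcard.symm
    have hfac : LambdaFactor.Fac (G.deleteEdges {s(a, b)}) (Finset.univ.erase x) := by
      by_cases hx : a ∈ Finset.univ.erase x ∧ b ∈ Finset.univ.erase x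
      · exact LambdaFactor.fac_delete_of_tc hS hc h3 hx.1 hx.2 hab
      -- The edge is incident with x, so every partition of G - x avoids it.
      · refine LambdaFactor.fac_delete_of_chain hc h3 (fun h => ?_) hx
        obtain ⟨s, hs, t, ht, hst⟩ := Finset.one_lt_card.1 (by omega :
          1 < (Finset.univ.erase x).card)
        exact ⟨s, t, hS.ch hs ht hst⟩
    obtain ⟨P, hPG, -, hP⟩ := hfac.exists_graph
    refine ⟨P.induce {v | v ≠ x}, fun u v h => hPG h, fun C => ?_⟩
    induction C using SimpleGraph.ConnectedComponent.ind with
    | h v =>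
      obtain ⟨a, ha, b, hb, c, hc, hac, hab, hbc, ha', hb', hc', hv⟩ := hP v
        (Finset.mem_erase.2 ⟨v.2, Finset.mem_univ _⟩)
      have hab' : (P.induce {v | v ≠ x}).Adj ⟨a, Finset.ne_of_mem_erase ha⟩
        ⟨b, Finset.ne_of_mem_erase hb⟩ := hab
      have hbc' : (P.induce {v | v ≠ x}).Adj ⟨b, Finset.ne_of_mem_erase hb⟩
        ⟨c, Finset.ne_of_mem_erase hc⟩ := hbc
      exact LambdaFactor.nonempty_iso_pathGraph_three (fun h => hac (congrArg Subtype.val h))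
        hab' hbc' (fun w h => Subtype.ext (ha' w h))
        (fun w h => (hb' w h).imp Subtype.ext Subtype.ext) (fun w h => Subtype.ext (hc' w h))
        (hv.imp Subtype.ext (Or.imp Subtype.ext Subtype.ext))
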